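/- Theorem (characteristic foliations of metric contact pairs are minimal). Everything is smooth. Let $M$ be a manifold and let $(\alpha_1,\alpha_2)$ be a contact pair of type $(h,k)$ on $M$, i.e. a pair of $1$-forms such that $\alpha_1\wedge(d\alpha_1)^h\wedge\alpha_2\wedge(d\alpha_2)^k$ is a volume form, $(d\alpha_1)^{h+1}=0$ and $(d\alpha_2)^{k+1}=0$ (so $\dim M=2h+2k+2$). Let $Z_1,Z_2$ be its Reeb vector fields, which are determined by $\alpha_i(Z_j)=\delta_{ij}$ and $i_{Z_j}d\alpha_i=0$ for $i,j\in\{1,2\}$. Let $\phi$ be a $(1,1)$-tensor field and $g$ a Riemannian metric on $M$ such that $(\alpha_1,\alpha_2,\phi,g)$ is a metric contact pair: $$\phi^2=-\mathrm{Id}+\alpha_1\otimes Z_1+\alpha_2\otimes Z_2,\qquad \phi(Z_1)=\phi(Z_2)=0,$$ $$g(X,\phi Y)=(d\alpha_1+d\alpha_2)(X,Y),\qquad g(X,Z_i)=\alpha_i(X)\quad(i=1,2)$$ for all vector fields $X,Y$, where $d\alpha(X,Y)=\tfrac12\bigl(X\alpha(Y)-Y\alpha(X)-\alpha([X,Y])\bigr)$.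 For $i=1,2$ let $T\mathcal F_i=\ker\alpha_i\cap\ker d\alpha_i$ be the characteristic distribution of $\alpha_i$, and assume that $\phi$ is decomposable, i.e. $\phi(T\mathcal F_i)\subset T\mathcal F_i$ for $i=1,2$. Then both characteristic foliations are minimal. That is, $T\mathcal F_1$ and $T\mathcal F_2$ are smooth integrable (closed under Lie brackets) distributions of rank $2k+1$ and $2h+1$; the trace over $T\mathcal F_i$ of its second fundamental form $(X,Y)\mapsto(\nabla_XY)^\perp$ (with $\nabla$ the Levi-Civita connection of $g$) vanishes at every point of $M$; and every leaf of $\mathcal F_i$ (maximal connected integral manifold of $T\mathcal F_i$) is a minimal immersed submanifold of $(M,g)$, i.e. its mean curvature vector vanishes identically. -/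

import Mathlib

open scoped Manifold ContDiff Bundle Topology

set_option linter.unusedSectionVars false
set_option linter.unusedSimpArgs false

noncomputable section

universe u

namespace ContactPair

/-! ### Forms on a single vector space -/

section Algebra

variable {V : Type*} [AddCommGroup V] [Module ℝ V]

/-- A linear form, seen as an alternating map of degree one. -/
def oneFormAlt (a : V →ₗ[ℝ] ℝ) : V [⋀^Fin 1]→ₗ[ℝ] ℝ :=
  AlternatingMap.ofSubsingleton ℝ V ℝ (0 : Fin 1) a

/-- The wedge product of alternating forms (the sum over shuffles). -/
def wedge {m n : ℕ} (a : V [⋀^Fin m]→ₗ[ℝ] ℝ) (b : V [⋀^Fin n]→ₗ[ℝ] ℝ) :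
    V [⋀^Fin (m + n)]→ₗ[ℝ] ℝ :=
  ((LinearMap.mul' ℝ ℝ).compAlternatingMap (a.domCoprod b)).domDomCongr finSumFinEquiv

/-- The exterior powers `b ^ n = b ∧ ⋯ ∧ b` of a two-form. -/
def wedgePow (b : V [⋀^Fin 2]→ₗ[ℝ] ℝ) : (n : ℕ) → V [⋀^Fin (2 * n)]→ₗ[ℝ] ℝ
  | 0 => AlternatingMap.constOfIsEmpty ℝ V (Fin 0) 1
  | n + 1 => wedge (wedgePow b n) b

end Algebra

/-! ### Vector fields and one-forms on a manifold -/

section Fields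

variable (E : Type*) [NormedAddCommGroup E] [NormedSpace ℝ E]
  (M : Type*) [TopologicalSpace M] [ChartedSpace E M]

/-- (Not necessarily smooth) vector fields. -/
abbrev VecField : Type _ := Π x : M, TangentSpace 𝓘(ℝ, E) x

/-- (Not necessarily smooth) one-forms. -/
abbrev OneForm : Type _ := Π x : M, TangentSpace 𝓘(ℝ, E) x →L[ℝ] ℝ

/-- (Not necessarily smooth) tensor fields of type `(1, 1)`. -/
abbrev EndField : Type _ :=
  Π x : M, TangentSpace 𝓘(ℝ, E) x →L[ℝ] TangentSpace 𝓘(ℝ, E) x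

/-- Families of tangent subspaces. -/
abbrev Distribution : Type _ := Π x : M, Submodule ℝ (TangentSpace 𝓘(ℝ, E) x)

variable {E M}
variable [IsManifold 𝓘(ℝ, E) ∞ M]

/-- The vector field `X` is smooth on the set `U`. -/
def IsSmoothOn (X : VecField E M) (U : Set M) : Prop :=
  ContMDiffOn 𝓘(ℝ, E) 𝓘(ℝ, E).tangent ∞ (fun x ↦ (X x : TangentBundle 𝓘(ℝ, E) M)) U

/-- A one-form is smooth if it is a smooth section of the cotangent bundle. -/
def IsSmoothOneForm (α : OneForm E M) : Prop :=
  ContMDiff 𝓘(ℝ, E) (𝓘(ℝ, E).prod 𝓘(ℝ, E →L[ℝ] ℝ)) ∞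
    (fun x ↦ Bundle.TotalSpace.mk' (E →L[ℝ] ℝ)
      (E := fun x : M ↦ TangentSpace 𝓘(ℝ, E) x →L[ℝ] Bundle.Trivial M ℝ x) x (α x))

/-- A tensor field of type `(1, 1)` is smooth if it is a smooth section of `Hom(TM, TM)`. -/
def IsSmoothEndField (φ : EndField E M) : Prop :=
  ContMDiff 𝓘(ℝ, E) (𝓘(ℝ, E).prod 𝓘(ℝ, E →L[ℝ] E)) ∞
    (fun x ↦ Bundle.TotalSpace.mk' (E →L[ℝ] E)
      (E := fun x : M ↦ TangentSpace 𝓘(ℝ, E) x →L[ℝ] TangentSpace 𝓘(ℝ, E) x) x (φ x))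

/-- The exterior derivative of a one-form at `x`: pull the form back to the model space by the
inverse of the chart at `x`, differentiate there, and pull the result back by the chart.
Normalization: `dα(X, Y) = X(α(Y)) - Y(α(X)) - α([X, Y])`. -/
def extDerivOneForm (α : OneForm E M) (x : M) : TangentSpace 𝓘(ℝ, E) x [⋀^Fin 2]→ₗ[ℝ] ℝ :=
  ((extDeriv
      (fun y : E ↦ ContinuousAlternatingMap.ofSubsingleton ℝ E ℝ (0 : Fin 1)
        ((α ((extChartAt 𝓘(ℝ, E) x).symm y)).comp
          (mfderiv 𝓘(ℝ, E) 𝓘(ℝ, E) (extChartAt 𝓘(ℝ, E) x).symm y)))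
      (extChartAt 𝓘(ℝ, E) x x)).compContinuousLinearMap
    (mfderiv 𝓘(ℝ, E) 𝓘(ℝ, E) (extChartAt 𝓘(ℝ, E) x) x)).toAlternatingMap

end Fields

/-! ### Contact pairs -/

section ContactPairs

variable {E : Type*} [NormedAddCommGroup E] [NormedSpace ℝ E]
  {M : Type*} [TopologicalSpace M] [ChartedSpace E M] [IsManifold 𝓘(ℝ, E) ∞ M]

/-- `(α₁, α₂)` is a contact pair of type `(h, k)` on `M`: the form
`α₁ ∧ (dα₁)^h ∧ α₂ ∧ (dα₂)^k` is a volume form (a nowhere vanishing form of top degree),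
`(dα₁)^(h+1) = 0` and `(dα₂)^(k+1) = 0`. -/
structure IsContactPair (h k : ℕ) (α₁ α₂ : OneForm E M) : Prop where
  smooth₁ : IsSmoothOneForm α₁
  smooth₂ : IsSmoothOneForm α₂
  finrank_eq : Module.finrank ℝ E = (1 + 2 * h) + (1 + 2 * k)
  volume_ne_zero : ∀ x,
    wedge (wedge (oneFormAlt (α₁ x).toLinearMap) (wedgePow (extDerivOneForm α₁ x) h))
      (wedge (oneFormAlt (α₂ x).toLinearMap) (wedgePow (extDerivOneForm α₂ x) k)) ≠ 0
  pow_eq_zero₁ : ∀ x, wedgePow (extDerivOneForm α₁ x) (h + 1) = 0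
  pow_eq_zero₂ : ∀ x, wedgePow (extDerivOneForm α₂ x) (k + 1) = 0

/-- The characteristic distribution `ker α ∩ ker dα` of a one-form, where `ker dα` consists of the
vectors `v` with `i_v dα = 0`. -/
def charDist (α : OneForm E M) : Distribution E M :=
  fun x ↦ LinearMap.ker (α x).toLinearMap ⊓ LinearMap.ker (extDerivOneForm α x).curryLeft

/-- `Z₁, Z₂` are the Reeb vector fields of the contact pair `(α₁, α₂)`. The equations determine
them completely. -/
structure IsReebPair (α₁ α₂ : OneForm E M) (Z₁ Z₂ : VecField E M) : Prop where
  smooth₁ : IsSmoothOn Z₁ Set.univ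
  smooth₂ : IsSmoothOn Z₂ Set.univ
  apply₁₁ : ∀ x, α₁ x (Z₁ x) = 1
  apply₂₂ : ∀ x, α₂ x (Z₂ x) = 1
  apply₁₂ : ∀ x, α₁ x (Z₂ x) = 0
  apply₂₁ : ∀ x, α₂ x (Z₁ x) = 0
  contract₁₁ : ∀ x, (extDerivOneForm α₁ x).curryLeft (Z₁ x) = 0
  contract₂₁ : ∀ x, (extDerivOneForm α₂ x).curryLeft (Z₁ x) = 0
  contract₁₂ : ∀ x, (extDerivOneForm α₁ x).curryLeft (Z₂ x) = 0
  contract₂₂ : ∀ x, (extDerivOneForm α₂ x).curryLeft (Z₂ x) = 0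

/-- `(α₁, α₂, φ)` is a contact pair structure of type `(h, k)` with Reeb vector fields
`Z₁, Z₂`. -/
structure IsContactPairStructure (h k : ℕ) (α₁ α₂ : OneForm E M)
    (Z₁ Z₂ : VecField E M) (φ : EndField E M) : Prop where
  contactPair : IsContactPair h k α₁ α₂
  reeb : IsReebPair α₁ α₂ Z₁ Z₂
  smooth : IsSmoothEndField φ
  sq_apply : ∀ x v, φ x (φ x v) = -v + α₁ x v • Z₁ x + α₂ x v • Z₂ x
  apply_reeb₁ : ∀ x, φ x (Z₁ x) = 0
  apply_reeb₂ : ∀ x, φ x (Z₂ x) = 0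

/-- `φ` is decomposable: it preserves both characteristic distributions. -/
def IsDecomposable (α₁ α₂ : OneForm E M) (φ : EndField E M) : Prop :=
  (∀ x, ∀ v ∈ charDist α₁ x, φ x v ∈ charDist α₁ x) ∧
    (∀ x, ∀ v ∈ charDist α₂ x, φ x v ∈ charDist α₂ x)

/-- The distribution `D` is integrable of rank `p`: it is a smooth subbundle of rank `p` of `TM`
and is closed under Lie brackets. -/
structure IsIntegrable (D : Distribution E M) (p : ℕ) : Prop where
  finrank_eq : ∀ x, Module.finrank ℝ (D x) = p
  smooth : ∀ x, ∃ U : Set M, IsOpen U ∧ x ∈ U ∧ ∃ X : Fin p → VecField E M,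
    (∀ i, IsSmoothOn (X i) U) ∧ ∀ y ∈ U, Submodule.span ℝ (Set.range fun i ↦ X i y) = D y
  involutive : ∀ (U : Set M), IsOpen U → ∀ X Y : VecField E M,
    IsSmoothOn X U → IsSmoothOn Y U → (∀ y ∈ U, X y ∈ D y) → (∀ y ∈ U, Y y ∈ D y) →
    ∀ y ∈ U, VectorField.mlieBracket 𝓘(ℝ, E) X Y y ∈ D y

/-- `f : L → M` is an integral manifold of `D`: an injectively immersed submanifold whose tangent
spaces are those of `D`. -/
structure IsIntegralManifold (D : Distribution E M) {p : ℕ}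
    {L : Type*} [TopologicalSpace L] [ChartedSpace (EuclideanSpace ℝ (Fin p)) L]
    (f : L → M) : Prop where
  contMDiff : ContMDiff 𝓘(ℝ, EuclideanSpace ℝ (Fin p)) 𝓘(ℝ, E) ∞ f
  injective : Function.Injective f
  injective_mfderiv : ∀ q,
    Function.Injective (mfderiv 𝓘(ℝ, EuclideanSpace ℝ (Fin p)) 𝓘(ℝ, E) f q)
  range_mfderiv : ∀ q,
    LinearMap.range (mfderiv 𝓘(ℝ, EuclideanSpace ℝ (Fin p)) 𝓘(ℝ, E) f q).toLinearMap = D (f q)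

/-- `f : L → M` is a leaf of `D`: a maximal connected integral manifold. -/
structure IsLeaf {M : Type u} [TopologicalSpace M] [ChartedSpace E M]
    (D : Distribution E M) {p : ℕ}
    {L : Type u} [TopologicalSpace L] [ChartedSpace (EuclideanSpace ℝ (Fin p)) L]
    (f : L → M) : Prop extends IsIntegralManifold (p := p) D f where
  connected : ConnectedSpace L
  maximal : ∀ (N : Type u) [TopologicalSpace N] [ChartedSpace (EuclideanSpace ℝ (Fin p)) N]
    [IsManifold 𝓘(ℝ, EuclideanSpace ℝ (Fin p)) ∞ N] [ConnectedSpace N] (g : N → M),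
    IsIntegralManifold (p := p) D g → (Set.range g ∩ Set.range f).Nonempty → Set.range g ⊆ Set.range f

end ContactPairs

/-! ### The Levi-Civita connection -/

section Riemannian

open Bundle

variable {E : Type*} [NormedAddCommGroup E] [NormedSpace ℝ E] [FiniteDimensional ℝ E]
  {M : Type*} [TopologicalSpace M] [ChartedSpace E M]

instance (x : M) : FiniteDimensional ℝ (TangentSpace 𝓘(ℝ, E) x) :=
  inferInstanceAs (FiniteDimensional ℝ E)

variable [IsManifold 𝓘(ℝ, E) ∞ M]
  [RiemannianBundle (fun x : M ↦ TangentSpace 𝓘(ℝ, E) x)]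
  [IsContMDiffRiemannianBundle 𝓘(ℝ, E) ∞ E (fun x : M ↦ TangentSpace 𝓘(ℝ, E) x)]

theorem mdifferentiableAt_inner {x : M} {Y Z : Π x : M, TangentSpace 𝓘(ℝ, E) x}
    (hY : MDiffAt (T% Y) x) (hZ : MDiffAt (T% Z) x) :
    MDiffAt (fun y ↦ inner ℝ (Y y) (Z y)) x :=
  MDifferentiableAt.inner_bundle (E := fun x : M ↦ TangentSpace 𝓘(ℝ, E) x) (b := fun x ↦ x) hY hZ

theorem mvfderiv_inner_smul {x : M} {X Z : Π x : M, TangentSpace 𝓘(ℝ, E) x} {f : M → ℝ}  (hf : MDiffAt f x)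
    (hX : MDiffAt (T% X) x) (hZ : MDiffAt (T% Z) x) (v : TangentSpace 𝓘(ℝ, E) x):
   mvfderiv 𝓘(ℝ, E) (fun y ↦ inner ℝ ((f • X) y) (Z y)) x v
        = f x * mvfderiv 𝓘(ℝ, E) (fun y ↦ inner ℝ (X y) (Z y)) x v
          + inner ℝ (X x) (Z x) * mvfderiv 𝓘(ℝ, E) f x v := by
  have h : (fun y ↦ inner ℝ ((f • X) y) (Z y)) = (fun y ↦ f y * inner ℝ (X y) (Z y)) := by
    funext y; exact real_inner_smul_left _ _ _
  rw [h, mvfderiv_fun_mul hf (mdifferentiableAt_inner hX hZ)]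
  rfl

theorem mvfderiv_inner_add {x : M} {X X' Z : Π x : M, TangentSpace 𝓘(ℝ, E) x}
    (hX : MDiffAt (T% X) x) (hX' : MDiffAt (T% X') x) (hZ : MDiffAt (T% Z) x) (v : TangentSpace 𝓘(ℝ, E) x):
   mvfderiv 𝓘(ℝ, E) (fun y ↦ inner ℝ ((X + X') y) (Z y)) x v
        = mvfderiv 𝓘(ℝ, E) (fun y ↦ inner ℝ (X y) (Z y)) x v
          + mvfderiv 𝓘(ℝ, E) (fun y ↦ inner ℝ (X' y) (Z y)) x v := by
  have h : (fun y ↦ inner ℝ ((X + X') y) (Z y)) = (fun y ↦ inner ℝ (X y) (Z y) + inner ℝ (X' y) (Z y)) := by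
    funext y; exact inner_add_left _ _ _
  rw [h, mvfderiv_fun_add (mdifferentiableAt_inner hX hZ) (mdifferentiableAt_inner hX' hZ)]
  rfl

/-- The right-hand side of the Koszul formula for `⟨∇_X Y, Z⟩` at `x`. -/
def koszul (X Y Z : Π x : M, TangentSpace 𝓘(ℝ, E) x) (x : M) : ℝ :=
  (1 / 2 : ℝ) *
    (mvfderiv 𝓘(ℝ, E) (fun y ↦ inner ℝ (Y y) (Z y)) x (X x)
      + mvfderiv 𝓘(ℝ, E) (fun y ↦ inner ℝ (X y) (Z y)) x (Y x)
      - mvfderiv 𝓘(ℝ, E) (fun y ↦ inner ℝ (X y) (Y y)) x (Z x)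
      + inner ℝ (VectorField.mlieBracket 𝓘(ℝ, E) X Y x) (Z x)
      - inner ℝ (VectorField.mlieBracket 𝓘(ℝ, E) X Z x) (Y x)
      - inner ℝ (VectorField.mlieBracket 𝓘(ℝ, E) Y Z x) (X x))

theorem koszul_tensorial₁ {x : M} {Y Z : Π x : M, TangentSpace 𝓘(ℝ, E) x}
    (hY : MDiffAt (T% Y) x) (hZ : MDiffAt (T% Z) x) :
    TensorialAt 𝓘(ℝ, E) E (fun X ↦ koszul X Y Z x) x where
  smul {f X} hf hX := by
    simp only [koszul, mvfderiv_inner_smul hf hX hZ, mvfderiv_inner_smul hf hX hY, VectorField.mlieBracket_smul_left hf hX]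
    simp only [Pi.smul_apply', map_smul, smul_eq_mul, inner_add_left, real_inner_smul_left, real_inner_smul_right,
      inner_neg_left]
    ring
  add {X X'} hX hX' := by
    simp only [koszul, mvfderiv_inner_add hX hX' hZ, mvfderiv_inner_add hX hX' hY, VectorField.mlieBracket_add_left hX hX']
    simp only [Pi.add_apply, map_add, inner_add_left, inner_add_right]
    ring

theorem mvfderiv_inner_comm (X Z : Π x : M, TangentSpace 𝓘(ℝ, E) x) (x : M) :
    mvfderiv 𝓘(ℝ, E) (fun y ↦ inner ℝ (X y) (Z y)) x =
      mvfderiv 𝓘(ℝ, E) (fun y ↦ inner ℝ (Z y) (X y)) x := by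
  have h : (fun y ↦ inner ℝ (X y) (Z y)) = (fun y ↦ inner ℝ (Z y) (X y)) := by
    funext y; exact real_inner_comm _ _
  rw [h]

theorem mvfderiv_inner_smul' {x : M} {X Z : Π x : M, TangentSpace 𝓘(ℝ, E) x} {f : M → ℝ}  (hf : MDiffAt f x)
    (hX : MDiffAt (T% X) x) (hZ : MDiffAt (T% Z) x) (v : TangentSpace 𝓘(ℝ, E) x):
   mvfderiv 𝓘(ℝ, E) (fun y ↦ inner ℝ (Z y) ((f • X) y)) x v
        = f x * mvfderiv 𝓘(ℝ, E) (fun y ↦ inner ℝ (Z y) (X y)) x v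
          + inner ℝ (Z x) (X x) * mvfderiv 𝓘(ℝ, E) f x v := by
  rw [mvfderiv_inner_comm, mvfderiv_inner_smul hf hX hZ, mvfderiv_inner_comm, real_inner_comm]

theorem mvfderiv_inner_add' {x : M} {X X' Z : Π x : M, TangentSpace 𝓘(ℝ, E) x}
    (hX : MDiffAt (T% X) x) (hX' : MDiffAt (T% X') x) (hZ : MDiffAt (T% Z) x) (v : TangentSpace 𝓘(ℝ, E) x):
   mvfderiv 𝓘(ℝ, E) (fun y ↦ inner ℝ (Z y) ((X + X') y)) x v
        = mvfderiv 𝓘(ℝ, E) (fun y ↦ inner ℝ (Z y) (X y)) x v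
          + mvfderiv 𝓘(ℝ, E) (fun y ↦ inner ℝ (Z y) (X' y)) x v := by
  rw [mvfderiv_inner_comm, mvfderiv_inner_add hX hX' hZ, mvfderiv_inner_comm Z X, mvfderiv_inner_comm Z X']

theorem koszul_tensorial₃ {x : M} {X Y : Π x : M, TangentSpace 𝓘(ℝ, E) x}
    (hX : MDiffAt (T% X) x) (hY : MDiffAt (T% Y) x) :
    TensorialAt 𝓘(ℝ, E) E (fun Z ↦ koszul X Y Z x) x where
  smul {f Z} hf hZ := by
    simp only [koszul, mvfderiv_inner_smul' hf hZ hX, mvfderiv_inner_smul' hf hZ hY, VectorField.mlieBracket_smul_right hf hZ]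
    simp only [Pi.smul_apply', map_smul, smul_eq_mul, inner_add_left, real_inner_smul_left, real_inner_smul_right]
    rw [real_inner_comm (X x) (Z x), real_inner_comm (Y x) (Z x)]
    ring
  add {Z Z'} hZ hZ' := by
    simp only [koszul, mvfderiv_inner_add' hZ hZ' hX, mvfderiv_inner_add' hZ hZ' hY, VectorField.mlieBracket_add_right hZ hZ']
    simp only [Pi.add_apply, map_add, inner_add_left, inner_add_right]
    ring

theorem koszul_smul_middle {x : M} {X Y Z : Π x : M, TangentSpace 𝓘(ℝ, E) x} {f : M → ℝ} (hf : MDiffAt f x)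
    (hX : MDiffAt (T% X) x) (hY : MDiffAt (T% Y) x) (hZ : MDiffAt (T% Z) x) :
    koszul X (f • Y) Z x = f x * koszul X Y Z x + mvfderiv 𝓘(ℝ, E) f x (X x) * inner ℝ (Y x) (Z x) := by
  simp only [koszul, mvfderiv_inner_smul hf hY hZ, mvfderiv_inner_smul' hf hY hX, VectorField.mlieBracket_smul_right hf hY,
    VectorField.mlieBracket_smul_left hf hY]
  simp only [Pi.smul_apply', map_smul, smul_eq_mul, inner_add_left, real_inner_smul_left, real_inner_smul_right]
  rw [real_inner_comm (X x) (Y x)]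
  ring

theorem koszul_add_middle {x : M} {X Y Y' Z : Π x : M, TangentSpace 𝓘(ℝ, E) x}
    (hX : MDiffAt (T% X) x) (hY : MDiffAt (T% Y) x) (hY' : MDiffAt (T% Y') x) (hZ : MDiffAt (T% Z) x) :
    koszul X (Y + Y') Z x = koszul X Y Z x + koszul X Y' Z x := by
  simp only [koszul, mvfderiv_inner_add hY hY' hZ, mvfderiv_inner_add' hY hY' hX, VectorField.mlieBracket_add_right hY hY',
    VectorField.mlieBracket_add_left hY hY']
  simp only [Pi.add_apply, map_add, inner_add_left, inner_add_right]
  ring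

open Classical in
/-- The bilinear form `(u, w) ↦ ⟨∇_u Y, w⟩` on `T_x M` (zero if `Y` is not differentiable at `x`). -/
def koszulForm (Y : Π x : M, TangentSpace 𝓘(ℝ, E) x) (x : M) :
    TangentSpace 𝓘(ℝ, E) x →L[ℝ] TangentSpace 𝓘(ℝ, E) x →L[ℝ] ℝ :=
  if hY : MDiffAt (T% Y) x then
    TensorialAt.mkHom₂ (I := 𝓘(ℝ, E)) (F := E) (F' := E) (fun X Z ↦ koszul X Y Z x) x
      (fun _ hZ ↦ koszul_tensorial₁ hY hZ) (fun _ hX ↦ koszul_tensorial₃ hX hY)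
  else 0

theorem koszulForm_apply {x : M} {X Y Z : Π x : M, TangentSpace 𝓘(ℝ, E) x}
    (hX : MDiffAt (T% X) x) (hY : MDiffAt (T% Y) x) (hZ : MDiffAt (T% Z) x) :
    koszulForm Y x (X x) (Z x) = koszul X Y Z x := by
  rw [koszulForm, dif_pos hY]
  exact TensorialAt.mkHom₂_apply _ _ hX hZ

/-- `∇ Y` at `x`, as the endomorphism of `T_x M` determined by the Koszul formula. -/
def leviCivitaFun (Y : Π x : M, TangentSpace 𝓘(ℝ, E) x) (x : M) :
    TangentSpace 𝓘(ℝ, E) x →L[ℝ] TangentSpace 𝓘(ℝ, E) x :=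
  letI : CompleteSpace (TangentSpace 𝓘(ℝ, E) x) := FiniteDimensional.complete ℝ _
  LinearMap.toContinuousLinearMap
    { toFun := fun u ↦ (InnerProductSpace.toDual ℝ (TangentSpace 𝓘(ℝ, E) x)).symm (koszulForm Y x u)
      map_add' := fun u v ↦ by rw [map_add, map_add]
      map_smul' := fun c u ↦ by
        rw [map_smul]
        exact LinearIsometryEquiv.map_smulₛₗ _ _ _ }

theorem inner_leviCivitaFun (Y : Π x : M, TangentSpace 𝓘(ℝ, E) x) (x : M) (u w : TangentSpace 𝓘(ℝ, E) x) :
    inner ℝ (leviCivitaFun Y x u) w = koszulForm Y x u w := by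
  have : CompleteSpace (TangentSpace 𝓘(ℝ, E) x) := FiniteDimensional.complete ℝ _
  exact InnerProductSpace.toDual_symm_apply (𝕜 := ℝ) (E := TangentSpace 𝓘(ℝ, E) x)
    (x := w) (y := koszulForm Y x u)

theorem inner_leviCivitaFun_eq_koszul {x : M} {X Y Z : Π x : M, TangentSpace 𝓘(ℝ, E) x}
    (hX : MDiffAt (T% X) x) (hY : MDiffAt (T% Y) x) (hZ : MDiffAt (T% Z) x) :
    inner ℝ (leviCivitaFun Y x (X x)) (Z x) = koszul X Y Z x := by
  rw [inner_leviCivitaFun, koszulForm_apply hX hY hZ]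

theorem tangent_hom_ext {x : M} {A B : TangentSpace 𝓘(ℝ, E) x →L[ℝ] TangentSpace 𝓘(ℝ, E) x}
    (h : ∀ X Z : Π x : M, TangentSpace 𝓘(ℝ, E) x, MDiffAt (T% X) x → MDiffAt (T% Z) x →
      inner ℝ (A (X x)) (Z x) = (inner ℝ (B (X x)) (Z x) : ℝ)) : A = B := by
  ext u
  refine ext_inner_right ℝ fun w ↦ ?_
  have := h (FiberBundle.extend E u) (FiberBundle.extend E w) (FiberBundle.mdifferentiableAt_extend ..)
    (FiberBundle.mdifferentiableAt_extend ..)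
  simpa using this

/-- The Levi-Civita connection of the Riemannian metric of `M`. It is metric and torsion-free, see
`leviCivita_isMetricCompatible` and `leviCivita_torsion`. -/
def leviCivita : CovariantDerivative 𝓘(ℝ, E) E (fun x : M ↦ TangentSpace 𝓘(ℝ, E) x) where
  toFun := leviCivitaFun
  isCovariantDerivativeOnUniv :=
    { add := fun {Y Y' x} hY hY' _ ↦ tangent_hom_ext fun X Z hX hZ ↦ by
        rw [inner_leviCivitaFun_eq_koszul hX (mdifferentiableAt_add_section hY hY') hZ, koszul_add_middle hX hY hY' hZ,
          add_apply, inner_add_left, inner_leviCivitaFun_eq_koszul hX hY hZ, inner_leviCivitaFun_eq_koszul hX hY' hZ]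
      leibniz := fun {Y f x} hY hf _ ↦ tangent_hom_ext fun X Z hX hZ ↦ by
        rw [inner_leviCivitaFun_eq_koszul hX (hf.smul_section hY) hZ, koszul_smul_middle hf hX hY hZ,
          add_apply, inner_add_left, smul_apply,
          ContinuousLinearMap.smulRight_apply, real_inner_smul_left,
          real_inner_smul_left, inner_leviCivitaFun_eq_koszul hX hY hZ] }

theorem leviCivita_isMetricCompatible : CovariantDerivative.IsMetricCompatible (V := fun x : M ↦ TangentSpace 𝓘(ℝ, E) x)
    (leviCivita : CovariantDerivative 𝓘(ℝ, E) E (fun x : M ↦ TangentSpace 𝓘(ℝ, E) x)) := by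
  rw [CovariantDerivative.isMetricCompatible_iff]
  intro x X Y Z hX hY hZ
  have h1 := inner_leviCivitaFun_eq_koszul hX hY hZ
  have h2 := inner_leviCivitaFun_eq_koszul hX hZ hY
  change _ = inner ℝ (leviCivitaFun Y x (X x)) (Z x) + inner ℝ (Y x) (leviCivitaFun Z x (X x))
  rw [real_inner_comm (leviCivitaFun Z x (X x)), h1, h2]
  simp only [koszul]
  rw [mvfderiv_inner_comm Z Y, VectorField.mlieBracket_swap (V := Z) (W := Y)]
  simp only [Pi.neg_apply, inner_neg_left]
  ring

theorem leviCivita_torsion :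
    (leviCivita : CovariantDerivative 𝓘(ℝ, E) E (fun x : M ↦ TangentSpace 𝓘(ℝ, E) x)).torsion = 0 := by
  have : CompleteSpace E := FiniteDimensional.complete ℝ E
  rw [CovariantDerivative.torsion_eq_zero_iff]
  intro X Y x hX hY
  refine ext_inner_right ℝ fun w ↦ ?_
  have hZ : MDiffAt (T% (FiberBundle.extend E w : Π x : M, TangentSpace 𝓘(ℝ, E) x)) x :=
    FiberBundle.mdifferentiableAt_extend ..
  have h1 := inner_leviCivitaFun_eq_koszul hX hY hZ
  have h2 := inner_leviCivitaFun_eq_koszul hY hX hZ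
  rw [FiberBundle.extend_apply_self] at h1 h2
  change inner ℝ (leviCivitaFun Y x (X x) - leviCivitaFun X x (Y x)) w = _
  rw [inner_sub_left, h1, h2]
  simp only [koszul]
  rw [mvfderiv_inner_comm Y X, VectorField.mlieBracket_swap (V := Y) (W := X)]
  simp only [Pi.neg_apply, inner_neg_left, FiberBundle.extend_apply_self]
  ring

/-! ### Metric contact pairs and minimality -/

/-- `(α₁, α₂, φ, g)` is a metric contact pair of type `(h, k)` with Reeb vector fields `Z₁, Z₂`,
where `g` is the Riemannian metric of `M`. In `g(X, φ Y) = (dα₁ + dα₂)(X, Y)` the normalization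
of the exterior derivative is the one usual in contact metric geometry,
`2 dα(X, Y) = X(α(Y)) - Y(α(X)) - α([X, Y])`, whence the factor `1 / 2`. -/
structure IsMetricContactPair (h k : ℕ) (α₁ α₂ : OneForm E M)
    (Z₁ Z₂ : VecField E M) (φ : EndField E M) : Prop
    extends IsContactPairStructure h k α₁ α₂ Z₁ Z₂ φ where
  inner_apply : ∀ (x : M) (u v : TangentSpace 𝓘(ℝ, E) x),
    inner ℝ u (φ x v) = (1 / 2 : ℝ) * (extDerivOneForm α₁ x + extDerivOneForm α₂ x) ![u, v]
  inner_reeb₁ : ∀ (x : M) (u : TangentSpace 𝓘(ℝ, E) x), inner ℝ u (Z₁ x) = α₁ x u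
  inner_reeb₂ : ∀ (x : M) (u : TangentSpace 𝓘(ℝ, E) x), inner ℝ u (Z₂ x) = α₂ x u

/-- The second fundamental form `II(u, v) = (∇_u V)^⊥` of a distribution `D` at `x`, where the
section `V` of `D` extending `v ∈ D x` is the projection to `D` of an arbitrary extension of `v`. -/
def distSecondFundamentalForm (D : Distribution E M) (x : M) (u v : TangentSpace 𝓘(ℝ, E) x) :
    TangentSpace 𝓘(ℝ, E) x :=
  (D x)ᗮ.starProjection
    (leviCivita (fun y ↦ (D y).starProjection (FiberBundle.extend E v y)) x u)

/-- The mean curvature vector (trace of the second fundamental form) of a distribution. -/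
def distMeanCurvature (D : Distribution E M) (x : M) : TangentSpace 𝓘(ℝ, E) x :=
  ∑ j, distSecondFundamentalForm D x (stdOrthonormalBasis ℝ (D x) j : TangentSpace 𝓘(ℝ, E) x)
    (stdOrthonormalBasis ℝ (D x) j : TangentSpace 𝓘(ℝ, E) x)

section Immersions

variable {p : ℕ} {L : Type*} [TopologicalSpace L] [ChartedSpace (EuclideanSpace ℝ (Fin p)) L]

/-- The covariant derivative `∇_u W` at `q` of a vector field `W` along `f : L → M`. In the
trivialization of `TM` at `f q` write `W = ∑ wᵢ sᵢ` with the coordinate frame `sᵢ`; then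
`∇_u W = ∑ dwᵢ(u) sᵢ + ∇_{df u} (∑ wᵢ(q) sᵢ)`, and `∑ wᵢ(q) sᵢ` is `FiberBundle.extend E (W q)`. -/
def covDerivAlong (f : L → M) (W : Π q : L, TangentSpace 𝓘(ℝ, E) (f q)) (q : L)
    (u : TangentSpace 𝓘(ℝ, EuclideanSpace ℝ (Fin p)) q) : TangentSpace 𝓘(ℝ, E) (f q) :=
  (trivializationAt E (TangentSpace 𝓘(ℝ, E)) (f q)).symm (f q)
      (mvfderiv 𝓘(ℝ, EuclideanSpace ℝ (Fin p))
        (fun q' ↦ (trivializationAt E (TangentSpace 𝓘(ℝ, E)) (f q)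
          (⟨f q', W q'⟩ : TangentBundle 𝓘(ℝ, E) M)).2) q u)
    + leviCivita (FiberBundle.extend E (W q)) (f q)
        (mfderiv 𝓘(ℝ, EuclideanSpace ℝ (Fin p)) 𝓘(ℝ, E) f q u)

/-- The second fundamental form `II(u, v) = (∇_u (f_* V))^⊥` of an immersion `f : L → M` at `q`,
where `V` is an arbitrary vector field on `L` extending `v`. -/
def secondFundamentalForm [IsManifold 𝓘(ℝ, EuclideanSpace ℝ (Fin p)) ∞ L] (f : L → M) (q : L)
    (u v : TangentSpace 𝓘(ℝ, EuclideanSpace ℝ (Fin p)) q) : TangentSpace 𝓘(ℝ, E) (f q) :=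
  (LinearMap.range
      (mfderiv 𝓘(ℝ, EuclideanSpace ℝ (Fin p)) 𝓘(ℝ, E) f q).toLinearMap)ᗮ.starProjection
    (covDerivAlong (E := E) f
      (fun q' ↦ mfderiv 𝓘(ℝ, EuclideanSpace ℝ (Fin p)) 𝓘(ℝ, E) f q'
        (FiberBundle.extend (EuclideanSpace ℝ (Fin p)) v q')) q u)

/-- The immersion `f : L → M` is minimal: its mean curvature vanishes, that is, at each point the
trace of the second fundamental form over an orthonormal basis for the induced metric is zero. -/
def IsMinimalImmersion [IsManifold 𝓘(ℝ, EuclideanSpace ℝ (Fin p)) ∞ L] (f : L → M) : Prop :=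
  ∀ (q : L) (e : Fin p → TangentSpace 𝓘(ℝ, EuclideanSpace ℝ (Fin p)) q),
    Orthonormal ℝ (fun i ↦ mfderiv 𝓘(ℝ, EuclideanSpace ℝ (Fin p)) 𝓘(ℝ, E) f q (e i)) →
    ∑ i, secondFundamentalForm (E := E) f q (e i) (e i) = 0

end Immersions

/-- The foliation tangent to the distribution `D` of rank `p` is minimal: `D` is integrable, its
mean curvature vanishes, and all its leaves are minimal submanifolds of `M`. -/
structure IsMinimalFoliation {M : Type u} [TopologicalSpace M] [ChartedSpace E M]
    [IsManifold 𝓘(ℝ, E) ∞ M]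
    [RiemannianBundle (fun x : M ↦ TangentSpace 𝓘(ℝ, E) x)]
    [IsContMDiffRiemannianBundle 𝓘(ℝ, E) ∞ E (fun x : M ↦ TangentSpace 𝓘(ℝ, E) x)]
    (D : Distribution E M) (p : ℕ) : Prop where
  integrable : IsIntegrable D p
  meanCurvature_eq_zero : ∀ x, distMeanCurvature D x = 0
  leaf_minimal : ∀ (L : Type u) [TopologicalSpace L] [ChartedSpace (EuclideanSpace ℝ (Fin p)) L]
    [IsManifold 𝓘(ℝ, EuclideanSpace ℝ (Fin p)) ∞ L] (f : L → M),
    IsLeaf (p := p) D f → IsMinimalImmersion (E := E) (p := p) f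

end Riemannian

end ContactPair

end

/-! Write D₁, D₂ for the characteristic distributions of α₁, α₂, and dα for the unhalved derivative
`extDerivOneForm`.

Linear algebra at a point: (dα₁)^(h+1) = 0 bounds the rank of dα₁ by 2h
(`finrank_le_of_wedgePow_eq_zero`), so dim D₁ ≥ 2k+1, and likewise dim D₂ ≥ 2h+1. A common vector of
D₁ and D₂ kills the volume form, so D₁ ∩ D₂ = 0 and both bounds are equalities. Decomposability of φ
makes D₁ and D₂ orthogonal, hence orthogonal complements of each other (`orthogonal_eq`). Each D is
involutive because L_X dα = 0 for every section X of D.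

Minimality of D₁ amounts to the vanishing of the trace over D₁ of u ↦ ⟨∇_u N, u⟩ for every section N
of D₂, since differentiating ⟨V, N⟩ = 0 turns ⟨∇_u V, N⟩ into -⟨V, ∇_u N⟩. On D₁ the metric is
controlled by the other form: ⟨u, φ v⟩ = ½ dα₂(u, v). As i_N dα₂ = 0 and dα₂ is closed, L_N dα₂ = 0.
Evaluated on (X, φX), with X in D₁ and α₂(X) = 0, this says N|X|² = ⟨[N, X], X⟩ + ⟨[N, φX], φX⟩.
Since ⟨∇_X N, X⟩ = ½ N|X|² - ⟨[N, X], X⟩ and |φX| = |X|, the contributions of X and φX cancel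
(`inner_leviCivita_add_eq_zero`). The one remaining direction Z₂ contributes -α₂([N, Z₂]) = dα₂(N,
Z₂) = 0 (`inner_leviCivita_reeb`). Summing over φ-pairs is the linear algebra of
`sum_bilin_eq_zero`.

The argument for the distribution and the one for a leaf differ only in how ∇_u V is computed; both
feed into `sum_starProjection_eq_zero`. All is stated for D₁ and transferred to D₂ by
`IsSplitMetricPair.symm`. -/

noncomputable section

universe u

namespace ContactPair

/-! ### Exterior algebra on a vector space: null vectors and the rank of a two-form. -/

section Algebra

variable {V : Type*} [AddCommGroup V] [Module ℝ V]

/-- The value of a summand of `wedge` at a permutation. -/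
def wedgeTerm {m n : ℕ} (a : V [⋀^Fin m]→ₗ[ℝ] ℝ) (b : V [⋀^Fin n]→ₗ[ℝ] ℝ)
    (Y : Fin m ⊕ Fin n → V) (σ : Equiv.Perm (Fin m ⊕ Fin n)) : ℝ :=
  (Equiv.Perm.sign σ : ℤ) * (a (fun i ↦ Y (σ (Sum.inl i))) * b (fun i ↦ Y (σ (Sum.inr i))))

theorem mul'_summand_mk {m n : ℕ} (a : V [⋀^Fin m]→ₗ[ℝ] ℝ) (b : V [⋀^Fin n]→ₗ[ℝ] ℝ)
    (Y : Fin m ⊕ Fin n → V) (σ : Equiv.Perm (Fin m ⊕ Fin n)) :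
    LinearMap.mul' ℝ ℝ (AlternatingMap.domCoprod.summand a b (Quotient.mk'' σ) Y) =
      wedgeTerm a b Y σ := by
  rw [AlternatingMap.domCoprod.summand_mk'', wedgeTerm]
  rcases Int.units_eq_one_or (Equiv.Perm.sign σ) with h | h <;> simp [h]

theorem wedge_apply {m n : ℕ} (a : V [⋀^Fin m]→ₗ[ℝ] ℝ) (b : V [⋀^Fin n]→ₗ[ℝ] ℝ)
    (v : Fin (m + n) → V) :
    wedge a b v = ∑ σ : Equiv.Perm.ModSumCongr (Fin m) (Fin n),
      LinearMap.mul' ℝ ℝ (AlternatingMap.domCoprod.summand a b σ (v ∘ finSumFinEquiv)) := by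
  simp only [wedge, AlternatingMap.domDomCongr_apply, LinearMap.compAlternatingMap_apply,
    AlternatingMap.domCoprod_apply, sum_apply, map_sum]

/-- The vectors all of whose contractions with `a` vanish. -/
def IsNull {m : ℕ} (a : V [⋀^Fin m]→ₗ[ℝ] ℝ) (v : V) : Prop :=
  ∀ x : Fin m → V, ∀ i, x i = v → a x = 0

/-- In each shuffle term the slot holding `v` is handed either to `a` or to `b`, and that factor
vanishes. -/
theorem IsNull.wedge {m n : ℕ} {a : V [⋀^Fin m]→ₗ[ℝ] ℝ} {b : V [⋀^Fin n]→ₗ[ℝ] ℝ} {v : V}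
    (ha : IsNull a v) (hb : IsNull b v) : IsNull (wedge a b) v := by
  intro x i hi
  rw [wedge_apply]
  refine Finset.sum_eq_zero fun σ _ ↦ ?_
  induction σ using Quotient.inductionOn' with | _ σ
  rw [mul'_summand_mk, wedgeTerm]
  rcases h : σ⁻¹ (finSumFinEquiv.symm i) with j | j
  · rw [ha _ j (by rw [← hi, ← h]; simp), zero_mul, mul_zero]
  · rw [hb _ j (by rw [← hi, ← h]; simp), mul_zero, mul_zero]

theorem IsNull.oneFormAlt {a : V →ₗ[ℝ] ℝ} {v : V} (h : a v = 0) : IsNull (oneFormAlt a) v := by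
  intro x i hi
  have : x 0 = v := by rw [← hi, Subsingleton.elim i 0]
  simp [ContactPair.oneFormAlt, this, h]

theorem apply_swap (b : V [⋀^Fin 2]→ₗ[ℝ] ℝ) (u v : V) : b ![v, u] = -b ![u, v] := by
  have := b.map_swap ![u, v] (i := 0) (j := 1) (by decide)
  rw [← this]
  congr 1
  ext i
  fin_cases i <;> rfl

theorem curryLeft_eq_zero_iff {b : V [⋀^Fin 2]→ₗ[ℝ] ℝ} {v : V} :
    b.curryLeft v = 0 ↔ ∀ u, b ![v, u] = 0 := by
  constructor
  · intro h u
    have := DFunLike.congr_fun h ![u]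
    simpa using this
  · intro h
    ext w
    have h2 : w = ![w 0] := by ext i; fin_cases i; rfl
    rw [AlternatingMap.curryLeft_apply_apply, h2]
    exact h _

theorem IsNull.two {b : V [⋀^Fin 2]→ₗ[ℝ] ℝ} {v : V} (h : ∀ u, b ![v, u] = 0) : IsNull b v := by
  intro x i hi
  have hx : x = ![x 0, x 1] := by ext i; fin_cases i <;> rfl
  rw [hx]
  fin_cases i
  · simp only [Fin.zero_eta, Fin.isValue] at hi
    rw [hi]; exact h _
  · simp only [Fin.mk_one, Fin.isValue] at hi
    rw [hi, apply_swap, h, neg_zero]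

theorem IsNull.wedgePow {b : V [⋀^Fin 2]→ₗ[ℝ] ℝ} {v : V} (h : IsNull b v) :
    ∀ n, IsNull (wedgePow b n) v
  | 0 => fun _ i ↦ i.elim0
  | n + 1 => (IsNull.wedgePow h n).wedge h

/-- A nonzero `v` would belong to a basis. A top-degree form is determined by its values on tuples
of distinct basis vectors, and such a tuple of full length contains `v`. -/
theorem eq_zero_of_isNull [FiniteDimensional ℝ V] {m : ℕ} (hm : Module.finrank ℝ V = m)
    {a : V [⋀^Fin m]→ₗ[ℝ] ℝ} (ha : a ≠ 0) {v : V} (hv : IsNull a v) : v = 0 := by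
  by_contra hne
  apply ha
  obtain ⟨i, hi⟩ : ∃ i : Fin m, True := by
    have : 0 < m := by rw [← hm]; exact Module.finrank_pos_iff_exists_ne_zero.mpr ⟨v, hne⟩
    exact ⟨⟨0, this⟩, trivial⟩
  obtain ⟨B, j, hB⟩ : ∃ (B : Module.Basis (Fin m) ℝ V) (j : Fin m), B j = v := by
    have hli : LinearIndepOn ℝ id ({v} : Set V) := LinearIndepOn.singleton hne
    let B := Module.Basis.extend hli
    have : Fintype (hli.extend (Set.subset_univ _)) := FiniteDimensional.fintypeBasisIndex B
    have hc : Fintype.card (hli.extend (Set.subset_univ _)) = m := by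
      rw [← hm, Module.finrank_eq_card_basis B]
    let e := Fintype.equivFinOfCardEq hc
    have hv : v ∈ hli.extend (Set.subset_univ _) := hli.subset_extend _ rfl
    refine ⟨B.reindex e, e ⟨v, hv⟩, ?_⟩
    simp [B]
  refine Module.Basis.ext_alternating B fun w hw ↦ ?_
  obtain ⟨i, hi⟩ := (Finite.injective_iff_surjective.mp hw) j
  rw [hv _ i (by rw [hi, hB])]
  rfl

/-- The vectors `e 0, f 0, e 1, f 1, …`. -/
def interleave {n : ℕ} (e f : Fin n → V) (i : Fin (2 * n)) : V :=
  if i.val % 2 = 0 then e ⟨i / 2, by omega⟩ else f ⟨i / 2, by omega⟩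

/-- `e, f` is a symplectic system for the two-form `b`. -/
structure IsSymplecticSystem (b : V [⋀^Fin 2]→ₗ[ℝ] ℝ) {n : ℕ} (e f : Fin n → V) : Prop where
  ee : ∀ i j, b ![e i, e j] = 0
  ff : ∀ i j, b ![f i, f j] = 0
  ef : ∀ i j, b ![e i, f j] = if i = j then 1 else 0

theorem IsSymplecticSystem.comp {b : V [⋀^Fin 2]→ₗ[ℝ] ℝ} {m n : ℕ} {e f : Fin n → V}
    (h : IsSymplecticSystem b e f) {g : Fin m → Fin n} (hg : Function.Injective g) :
    IsSymplecticSystem b (e ∘ g) (f ∘ g) where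
  ee _ _ := h.ee _ _
  ff _ _ := h.ff _ _
  ef i j := by simp [h.ef, hg.eq_iff]

/-- The term depends only on the class of the permutation modulo permutations preserving the two
blocks. By finiteness, mapping the right block into itself already forces the left block to be
preserved. -/
theorem wedgeTerm_congr {m n : ℕ} (a : V [⋀^Fin m]→ₗ[ℝ] ℝ) (b : V [⋀^Fin n]→ₗ[ℝ] ℝ)
    (Y : Fin m ⊕ Fin n → V) {σ τ : Equiv.Perm (Fin m ⊕ Fin n)}
    (h : Set.MapsTo (τ⁻¹ * σ) (Set.range Sum.inr) (Set.range Sum.inr)) :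
    wedgeTerm a b Y σ = wedgeTerm a b Y τ := by
  rw [← mul'_summand_mk, ← mul'_summand_mk]
  congr 3
  refine Quotient.sound' ?_
  rw [QuotientGroup.leftRel_apply]
  have h1 : σ⁻¹ * τ = (τ⁻¹ * σ)⁻¹ := by group
  rw [h1]
  refine Subgroup.inv_mem _ (Equiv.Perm.mem_sumCongrHom_range_of_perm_mapsTo_inl ?_)
  choose g hg using fun i ↦ h ⟨i, rfl⟩
  have hinj : Function.Injective g := fun i j hij ↦ by
    have := (hg i).symm.trans ((congrArg Sum.inr hij).trans (hg j))
    exact Sum.inr_injective ((τ⁻¹ * σ).injective this)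
  rintro _ ⟨i, rfl⟩
  rcases hi : (τ⁻¹ * σ) (Sum.inl i) with j | j
  · exact ⟨j, rfl⟩
  · obtain ⟨k, rfl⟩ := (Finite.injective_iff_surjective.mp hinj) j
    exact absurd ((τ⁻¹ * σ).injective (hi.trans (hg k))) (by simp)

/-- The vectors `e 0, f 0, e 1, f 1, …`, for the decomposition of the index type used by
`wedge`. -/
def interleaveSum {n : ℕ} (e f : Fin (n + 1) → V) : Fin (2 * n) ⊕ Fin 2 → V :=
  interleave e f ∘ finSumFinEquiv (m := 2 * n) (n := 2)

theorem interleaveSum_inl {n : ℕ} (e f : Fin (n + 1) → V) :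
    (fun i ↦ interleaveSum e f (Sum.inl i)) =
      interleave (e ∘ Fin.castSucc) (f ∘ Fin.castSucc) := rfl

/-- The positions of `e` and `f` in `interleave e f`, for the decomposition of the index type used
by `wedge`. -/
def interleavePos {n : ℕ} (j : Fin (n + 1)) (t : Fin 2) : Fin (2 * n) ⊕ Fin 2 :=
  finSumFinEquiv.symm (⟨2 * j + t, by omega⟩ : Fin (2 * n + 2))

theorem exists_interleavePos {n : ℕ} (s : Fin (2 * n) ⊕ Fin 2) :
    ∃ (j : Fin (n + 1)) (t : Fin 2), s = interleavePos j t := by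
  have h := (finSumFinEquiv s).isLt
  refine ⟨⟨(finSumFinEquiv s).val / 2, by omega⟩, ⟨(finSumFinEquiv s).val % 2, by omega⟩, ?_⟩
  rw [interleavePos, Equiv.eq_symm_apply]
  ext
  simp only
  omega

theorem interleaveSum_interleavePos_zero {n : ℕ} (e f : Fin (n + 1) → V) (j : Fin (n + 1)) :
    interleaveSum e f (interleavePos j 0) = e j := by
  simp [interleaveSum, interleave, interleavePos]

theorem interleaveSum_interleavePos_one {n : ℕ} (e f : Fin (n + 1) → V) (j : Fin (n + 1)) :
    interleaveSum e f (interleavePos j 1) = f j := by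
  simp [interleaveSum, interleave, interleavePos]
  congr 1
  ext
  simp only
  omega

theorem interleavePos_inj {n : ℕ} {j j' : Fin (n + 1)} {t t' : Fin 2} :
    interleavePos j t = interleavePos j' t' ↔ j = j' ∧ t = t' := by
  rw [interleavePos, interleavePos, Equiv.apply_eq_iff_eq, Fin.ext_iff, Fin.ext_iff, Fin.ext_iff]
  simp only
  omega

theorem interleavePos_last {n : ℕ} (t : Fin 2) :
    interleavePos (Fin.last n) t = Sum.inr t := by
  rw [interleavePos, Equiv.symm_apply_eq]
  ext
  simp

/-- The permutation that exchanges the `j`-th pair and the last one. -/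
def pairSwap {n : ℕ} (j : Fin (n + 1)) : Equiv.Perm (Fin (2 * n) ⊕ Fin 2) :=
  Equiv.swap (interleavePos j 0) (interleavePos (Fin.last n) 0) *
    Equiv.swap (interleavePos j 1) (interleavePos (Fin.last n) 1)

/-- Whole pairs are exchanged, so the permutation is a product of two transpositions or the
identity; this is why no signs appear in powers of a two-form. -/
theorem sign_pairSwap {n : ℕ} (j : Fin (n + 1)) : Equiv.Perm.sign (pairSwap j) = 1 := by
  rw [pairSwap, Equiv.Perm.sign_mul, Equiv.Perm.sign_swap', Equiv.Perm.sign_swap']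
  simp only [interleavePos_inj, and_true]
  split_ifs <;> simp

theorem pairSwap_apply {n : ℕ} (j i : Fin (n + 1)) (t : Fin 2) :
    pairSwap j (interleavePos i t) = interleavePos (Equiv.swap j (Fin.last n) i) t := by
  rw [pairSwap, Equiv.Perm.mul_apply]
  simp only [Equiv.swap_apply_def, interleavePos_inj]
  fin_cases t <;> simp <;> split_ifs <;> simp_all [interleavePos_inj]

theorem interleaveSum_pairSwap {n : ℕ} (e f : Fin (n + 1) → V) (j : Fin (n + 1))
    (s : Fin (2 * n) ⊕ Fin 2) :
    interleaveSum e f (pairSwap j s) =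
      interleaveSum (e ∘ Equiv.swap j (Fin.last n)) (f ∘ Equiv.swap j (Fin.last n)) s := by
  obtain ⟨i, t, rfl⟩ := exists_interleavePos s
  rw [pairSwap_apply]
  fin_cases t <;>
    simp only [Fin.zero_eta, Fin.mk_one, interleaveSum_interleavePos_zero,
      interleaveSum_interleavePos_one, Function.comp_apply]

/-- Induction on `n`. A shuffle term survives only if the last factor receives a matching pair `e j,
f j`; it then equals the term of `pairSwap j`, which is a smaller power on the remaining pairs and
is positive. Only positivity is needed, not the value `n!`. -/
theorem wedgePow_interleave_pos (b : V [⋀^Fin 2]→ₗ[ℝ] ℝ) :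
    ∀ {n : ℕ} {e f : Fin n → V}, IsSymplecticSystem b e f → 0 < wedgePow b n (interleave e f)
  | 0, _, _, _ => by
    change (0 : ℝ) < 1
    norm_num
  | n + 1, e, f, h => by
    have key (j : Fin (n + 1)) : 0 < wedgeTerm (wedgePow b n) b
        (interleaveSum e f) (pairSwap j) := by
      have h' := h.comp (Equiv.swap j (Fin.last n)).injective
      rw [wedgeTerm, sign_pairSwap]
      simp only [interleaveSum_pairSwap]
      have h1 : b (fun i ↦ interleaveSum (e ∘ Equiv.swap j (Fin.last n))
          (f ∘ Equiv.swap j (Fin.last n)) (Sum.inr i)) = 1 := by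
        rw [← (h.ef j j).trans (if_pos rfl)]
        congr 1
        ext i
        rw [← interleavePos_last]
        fin_cases i
        · simp [interleaveSum_interleavePos_zero]
        · simp [interleaveSum_interleavePos_one]
      rw [h1, interleaveSum_inl]
      have h2 := wedgePow_interleave_pos b (h'.comp (Fin.castSucc_injective n))
      simpa using h2
    change 0 < wedge (wedgePow b n) b (interleave e f)
    rw [wedge_apply]
    refine Finset.sum_pos' (fun σ _ ↦ ?_) ⟨Quotient.mk'' (pairSwap (Fin.last n)),
      Finset.mem_univ _, ?_⟩
    · induction σ using Quotient.inductionOn' with | _ σ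
      rw [mul'_summand_mk]
      by_cases h0 : wedgeTerm (wedgePow b n) b (interleaveSum e f) σ = 0
      · exact h0.ge
      obtain ⟨j, t, hjt⟩ := exists_interleavePos (σ (Sum.inr 0))
      obtain ⟨j', t', hjt'⟩ := exists_interleavePos (σ (Sum.inr 1))
      have hb : b ![interleaveSum e f (σ (Sum.inr 0)),
          interleaveSum e f (σ (Sum.inr 1))] ≠ 0 := by
        intro hb
        apply h0
        rw [wedgeTerm]
        have : (fun i ↦ interleaveSum e f (σ (Sum.inr i))) =
            ![interleaveSum e f (σ (Sum.inr 0)),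
              interleaveSum e f (σ (Sum.inr 1))] := by
          ext i; fin_cases i <;> rfl
        rw [this, hb, mul_zero, mul_zero]
      have hj : j = j' := by
        by_contra hne
        apply hb
        rw [hjt, hjt']
        fin_cases t <;> fin_cases t' <;>
          simp only [Fin.zero_eta, Fin.mk_one, interleaveSum_interleavePos_zero,
            interleaveSum_interleavePos_one, h.ee, h.ff, h.ef, if_neg hne]
        rw [apply_swap, h.ef, if_neg (Ne.symm hne), neg_zero]
      subst hj
      -- The order of `e j` and `f j` in the last two slots is irrelevant: exchanging them stays
      -- within the same class.
      rw [wedgeTerm_congr (τ := pairSwap j)]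
      · exact (key j).le
      · rintro _ ⟨i, rfl⟩
        rw [Equiv.Perm.mul_apply]
        have hh (t : Fin 2) : (pairSwap j)⁻¹ (interleavePos j t) = Sum.inr t := by
          rw [Equiv.Perm.inv_eq_iff_eq, ← interleavePos_last, pairSwap_apply]
          simp
        fin_cases i
        · simp only [Fin.zero_eta, hjt, hh]; exact ⟨_, rfl⟩
        · simp only [Fin.mk_one, hjt', hh]; exact ⟨_, rfl⟩
    · rw [mul'_summand_mk]
      exact key _

/-- A two-form as a bilinear map. -/
def twoFormBilin (b : V [⋀^Fin 2]→ₗ[ℝ] ℝ) : V →ₗ[ℝ] V →ₗ[ℝ] ℝ :=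
  LinearMap.mk₂ ℝ (fun u v ↦ b ![u, v])
    (fun u u' v ↦ b.map_vecCons_add ![v] u u')
    (fun c u v ↦ b.map_vecCons_smul ![v] c u)
    (fun u v v' ↦ by
      rw [apply_swap b (v + v') u, apply_swap b v u, apply_swap b v' u]
      have := b.map_vecCons_add ![u] v v'
      linarith)
    (fun c u v ↦ by
      rw [apply_swap b (c • v) u, apply_swap b v u]
      have : b ![c • v, u] = c • b ![v, u] := b.map_vecCons_smul ![u] c v
      rw [this, smul_neg])

theorem twoFormBilin_apply (b : V [⋀^Fin 2]→ₗ[ℝ] ℝ) (u v : V) :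
    twoFormBilin b u v = b ![u, v] := rfl

/-- Symplectic Gram–Schmidt: a vector `u` orthogonal to the system but outside the radical of `b`
yields one more pair. -/
theorem IsSymplecticSystem.extend {b : V [⋀^Fin 2]→ₗ[ℝ] ℝ} {m : ℕ} {e f : Fin m → V}
    (h : IsSymplecticSystem b e f) {u v : V} (hue : ∀ i, b ![u, e i] = 0)
    (huf : ∀ i, b ![u, f i] = 0) (huv : b ![u, v] ≠ 0) :
    ∃ e' f' : Fin (m + 1) → V, IsSymplecticSystem b e' f' := by
  let B := twoFormBilin b
  have hB (x y : V) : b ![x, y] = B x y := rfl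
  have hsw (x y : V) : B y x = -B x y := apply_swap b x y
  have hself (x : V) : B x x = 0 := by have := hsw x x; linarith
  -- The signs are chosen so that `w` is `b`-orthogonal to every `e i` and `f i`; since `u` is
  -- orthogonal to them too, `B u w = B u v`, and rescaling makes this value 1.
  let w := v + ∑ i, (B (f i) v • e i - B (e i) v • f i)
  have huw : B u w = B u v := by
    have h1 (i) : B u (e i) = 0 := hue i
    have h2 (i) : B u (f i) = 0 := huf i
    simp only [w, map_add, map_sum, map_sub, map_smul, h1, h2]
    simp
  have hee (i j) : B (e i) (e j) = 0 := h.ee i j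
  have hff (i j) : B (f i) (f j) = 0 := h.ff i j
  have hef (i j) : B (e i) (f j) = if i = j then 1 else 0 := h.ef i j
  have hfe (i j) : B (f i) (e j) = -if j = i then 1 else 0 := by rw [hsw, hef]
  have hew (i) : B (e i) w = 0 := by
    simp only [w, map_add, map_sum, map_sub, map_smul, hee, hef]
    simp
  have hfw (i) : B (f i) w = 0 := by
    simp only [w, map_add, map_sum, map_sub, map_smul, hff, hfe]
    simp
  have hwf (i) : B w (f i) = 0 := by rw [hsw, hfw, neg_zero]
  refine ⟨Fin.cons u e, Fin.cons ((B u v)⁻¹ • w) f, ⟨fun i j ↦ ?_, fun i j ↦ ?_, fun i j ↦ ?_⟩⟩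
  all_goals
    rw [hB]
    refine Fin.cases ?_ (fun i ↦ ?_) i <;> refine Fin.cases ?_ (fun j ↦ ?_) j <;>
      simp only [Fin.cons_zero, Fin.cons_succ, map_smul, LinearMap.smul_apply, hew, hfw, hwf, huw,
        hee, hff, hef, hself, Fin.succ_inj, smul_zero, if_true, Fin.succ_ne_zero, if_false]
  · exact hue j
  · rw [hsw, ← hB, hue, neg_zero]
  · exact inv_mul_cancel₀ huv
  · rw [← hB, huf, if_neg (Fin.succ_ne_zero j).symm]

/-- If `b ^ (n + 1) = 0`, then the rank of `b` is at most `2 n`. -/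
theorem finrank_le_of_wedgePow_eq_zero [FiniteDimensional ℝ V] {b : V [⋀^Fin 2]→ₗ[ℝ] ℝ} {n : ℕ}
    (hb : wedgePow b (n + 1) = 0) :
    Module.finrank ℝ V ≤ Module.finrank ℝ (LinearMap.ker b.curryLeft) + 2 * n := by
  classical
  let P (m : ℕ) : Prop := ∃ e f : Fin m → V, IsSymplecticSystem b e f
  have hP : ¬ P (n + 1) := by
    rintro ⟨e, f, h⟩
    have := wedgePow_interleave_pos b h
    rw [hb] at this
    exact this.ne' rfl
  -- A number of pairs `m ≤ n` beyond which no larger system exists: size 0 is attained, and size `n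
  -- + 1` would make the vanishing power positive.
  obtain ⟨m, hmn, ⟨e, f, h⟩, hm⟩ : ∃ m ≤ n, P m ∧ ¬ P (m + 1) := by
    by_contra! hcon
    have : ∀ m ≤ n + 1, P m := fun m ↦ by
      induction m with
      | zero => exact fun _ ↦ ⟨Fin.elim0, Fin.elim0, ⟨fun i ↦ i.elim0, fun i ↦ i.elim0,
          fun i ↦ i.elim0⟩⟩
      | succ m ih => exact fun hm ↦ hcon m (by omega) (ih (by omega))
    exact hP (this _ le_rfl)
  let T : V →ₗ[ℝ] (Fin m → ℝ) × (Fin m → ℝ) :=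
    (LinearMap.pi fun i ↦ (twoFormBilin b).flip (e i)).prod
      (LinearMap.pi fun i ↦ (twoFormBilin b).flip (f i))
  -- The kernel of `T` is the `b`-orthogonal complement of the system. By maximality it lies in the
  -- radical, and `T` takes values in dimension `2 * m`.
  have hT : LinearMap.ker T ≤ LinearMap.ker b.curryLeft := by
    intro u hu
    rw [LinearMap.mem_ker, curryLeft_eq_zero_iff]
    intro v
    by_contra huv
    have h1 := congrArg Prod.fst (LinearMap.mem_ker.mp hu)
    have h2 := congrArg Prod.snd (LinearMap.mem_ker.mp hu)
    exact hm (h.extend (fun i ↦ congrFun h1 i) (fun i ↦ congrFun h2 i) huv)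
  have h1 := T.finrank_range_add_finrank_ker
  have h2 := Submodule.finrank_mono hT
  have h3 := (LinearMap.range T).finrank_le
  simp only [Module.finrank_prod, Module.finrank_fin_fun] at h3
  omega

theorem finrank_ker_le_finrank_inf_ker_add_one [FiniteDimensional ℝ V] (W : Submodule ℝ V)
    (a : V →ₗ[ℝ] ℝ) :
    Module.finrank ℝ W ≤ Module.finrank ℝ (LinearMap.ker a ⊓ W : Submodule ℝ V) + 1 := by
  have h1 := (a.domRestrict W).finrank_range_add_finrank_ker
  have h2 := (LinearMap.range (a.domRestrict W)).finrank_le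
  have h3 : Module.finrank ℝ (LinearMap.ker (a.domRestrict W)) ≤
      Module.finrank ℝ (LinearMap.ker a ⊓ W : Submodule ℝ V) := by
    have : (LinearMap.ker (a.domRestrict W)).map W.subtype ≤ LinearMap.ker a ⊓ W := by
      rintro _ ⟨w, hw, rfl⟩
      exact ⟨hw, w.2⟩
    rw [← Submodule.finrank_map_subtype_eq]
    exact Submodule.finrank_mono this
  simp only [Module.finrank_self] at h2
  omega

end Algebra

/-! ### Ranks of the characteristic distributions. -/

section Pointwise

variable {E : Type*} [NormedAddCommGroup E] [NormedSpace ℝ E] [FiniteDimensional ℝ E]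
  {M : Type*} [TopologicalSpace M] [ChartedSpace E M] [IsManifold 𝓘(ℝ, E) ∞ M]
  {h k : ℕ} {α₁ α₂ : OneForm E M}

theorem mem_charDist_iff {α : OneForm E M} {x : M} {v : TangentSpace 𝓘(ℝ, E) x} :
    v ∈ charDist α x ↔ α x v = 0 ∧ ∀ u, extDerivOneForm α x ![v, u] = 0 := by
  rw [charDist, Submodule.mem_inf, LinearMap.mem_ker, LinearMap.mem_ker, curryLeft_eq_zero_iff]
  rfl

/-- A common vector is null for all four factors of the volume form, hence for the volume form
itself. -/
theorem IsContactPair.disjoint (H : IsContactPair h k α₁ α₂) (x : M) :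
    charDist α₁ x ⊓ charDist α₂ x = ⊥ := by
  rw [eq_bot_iff]
  rintro v ⟨h1, h2⟩
  obtain ⟨h11, h12⟩ := mem_charDist_iff.mp h1
  obtain ⟨h21, h22⟩ := mem_charDist_iff.mp h2
  exact eq_zero_of_isNull H.finrank_eq (H.volume_ne_zero x)
    (((IsNull.oneFormAlt h11).wedge ((IsNull.two h12).wedgePow h)).wedge
      ((IsNull.oneFormAlt h21).wedge ((IsNull.two h22).wedgePow k)))

/-- The vanishing powers give lower bounds adding up to the dimension of the whole space; the
trivial intersection gives the matching upper bound for the sum. -/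
theorem IsContactPair.finrank_charDist (H : IsContactPair h k α₁ α₂) (x : M) :
    Module.finrank ℝ (charDist α₁ x) = 2 * k + 1 ∧
      Module.finrank ℝ (charDist α₂ x) = 2 * h + 1 := by
  have hV : Module.finrank ℝ (TangentSpace 𝓘(ℝ, E) x) = (1 + 2 * h) + (1 + 2 * k) := H.finrank_eq
  have h1 := finrank_le_of_wedgePow_eq_zero (H.pow_eq_zero₁ x)
  have h2 := finrank_le_of_wedgePow_eq_zero (H.pow_eq_zero₂ x)
  have h3 := finrank_ker_le_finrank_inf_ker_add_one
    (LinearMap.ker (extDerivOneForm α₁ x).curryLeft) (α₁ x).toLinearMap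
  have h4 := finrank_ker_le_finrank_inf_ker_add_one
    (LinearMap.ker (extDerivOneForm α₂ x).curryLeft) (α₂ x).toLinearMap
  have h5 := Submodule.finrank_sup_add_finrank_inf_eq (charDist α₁ x) (charDist α₂ x)
  have h6 := (charDist α₁ x ⊔ charDist α₂ x).finrank_le
  rw [H.disjoint, finrank_bot] at h5
  change _ ≤ Module.finrank ℝ (charDist α₁ x) + 1 at h3
  change _ ≤ Module.finrank ℝ (charDist α₂ x) + 1 at h4
  omega

end Pointwise
end ContactPair

/-! ### Calculus in charts: exterior derivative, brackets and the Lie derivative of dα. -/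

namespace ContactPair

/-- A linear form on a finite-dimensional space depends linearly on its values on finitely many
vectors. -/
theorem exists_clm_eq_apply (E : Type*) [NormedAddCommGroup E] [NormedSpace ℝ E]
    [FiniteDimensional ℝ E] :
    ∃ (w : Fin (Module.finrank ℝ E) → E) (Φ : (Fin (Module.finrank ℝ E) → ℝ) →L[ℝ] (E →L[ℝ] ℝ)),
      ∀ A : E →L[ℝ] ℝ, A = Φ fun i ↦ A (w i) := by
  let B := Module.finBasis ℝ E
  refine ⟨B, LinearMap.toContinuousLinearMap
    (∑ i, (LinearMap.proj i).smulRight (LinearMap.toContinuousLinearMap (B.coord i))), fun A ↦ ?_⟩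
  ext v
  have h := congrArg A (B.sum_repr v)
  rw [map_sum] at h
  simp only [map_smul, smul_eq_mul] at h
  simp only [LinearMap.coe_toContinuousLinearMap', LinearMap.sum_apply, LinearMap.smulRight_apply,
    LinearMap.proj_apply, sum_apply, smul_apply,
    smul_eq_mul, Module.Basis.coord_apply]
  rw [← h]
  exact Finset.sum_congr rfl fun i _ ↦ mul_comm _ _

section Calculus

open VectorField

variable {E : Type*} [NormedAddCommGroup E] [NormedSpace ℝ E] [FiniteDimensional ℝ E]
  {M : Type*} [TopologicalSpace M] [ChartedSpace E M] [IsManifold 𝓘(ℝ, E) ∞ M]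

/-- The derivative at `x` of the chart at `x`. -/
def chartDeriv (x : M) : TangentSpace 𝓘(ℝ, E) x →L[ℝ] E :=
  mfderiv 𝓘(ℝ, E) 𝓘(ℝ, E) (extChartAt 𝓘(ℝ, E) x) x

/-- The derivative of the inverse of the chart at `x`. -/
def chartSymmDeriv (x : M) (y : E) :
    E →L[ℝ] TangentSpace 𝓘(ℝ, E) ((extChartAt 𝓘(ℝ, E) x).symm y) :=
  mfderiv 𝓘(ℝ, E) 𝓘(ℝ, E) (extChartAt 𝓘(ℝ, E) x).symm y

/-- The pullback of a vector field to the model space by the inverse of the chart at `x`. -/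
def pullField (x : M) (X : VecField E M) (y : E) : E :=
  (chartSymmDeriv x y).inverse (X ((extChartAt 𝓘(ℝ, E) x).symm y))

theorem mpullbackWithin_eq_pullField (x : M) (X : VecField E M) :
    mpullbackWithin 𝓘(ℝ, E) 𝓘(ℝ, E) (extChartAt 𝓘(ℝ, E) x).symm X (Set.range 𝓘(ℝ, E)) =
      pullField x X := by
  ext y
  simp only [mpullbackWithin_apply, modelWithCornersSelf_coe, Set.range_id,
    mfderivWithin_univ]
  rfl

theorem differentiableAt_pullField {x : M} {X : VecField E M} (hX : MDiffAt (T% X) x) :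
    DifferentiableAt ℝ (pullField x X) (extChartAt 𝓘(ℝ, E) x x) := by
  have : CompleteSpace E := FiniteDimensional.complete ℝ E
  have h := hX.mdifferentiableWithinAt (s := Set.univ)
    |>.differentiableWithinAt_mpullbackWithin_vectorField
  rw [mpullbackWithin_eq_pullField] at h
  rw [← differentiableWithinAt_univ]
  simpa using h

theorem isInvertible_chartSymmDeriv (x : M) {y : E}
    (hy : y ∈ (extChartAt 𝓘(ℝ, E) x).target) : (chartSymmDeriv x y).IsInvertible := by
  have := isInvertible_mfderivWithin_extChartAt_symm (I := 𝓘(ℝ, E)) hy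
  simp only [modelWithCornersSelf_coe, Set.range_id, mfderivWithin_univ] at this
  exact this

theorem isInvertible_chartDeriv (x : M) : (chartDeriv (E := E) x).IsInvertible :=
  isInvertible_mfderiv_extChartAt (I := 𝓘(ℝ, E)) (mem_extChartAt_source x)

theorem chartSymmDeriv_pullField (x : M) (X : VecField E M) {y : E}
    (hy : y ∈ (extChartAt 𝓘(ℝ, E) x).target) :
    chartSymmDeriv x y (pullField x X y) = X ((extChartAt 𝓘(ℝ, E) x).symm y) :=
  (isInvertible_chartSymmDeriv x hy).self_apply_inverse _

theorem mfderiv_extChartAt_chartSymmDeriv (x : M) {y : E}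
    (hy : y ∈ (extChartAt 𝓘(ℝ, E) x).target) (v : E) :
    mfderiv 𝓘(ℝ, E) 𝓘(ℝ, E) (extChartAt 𝓘(ℝ, E) x) ((extChartAt 𝓘(ℝ, E) x).symm y)
      (chartSymmDeriv x y v) = v := by
  have := mfderiv_extChartAt_comp_mfderivWithin_extChartAt_symm (I := 𝓘(ℝ, E)) hy
  simp only [modelWithCornersSelf_coe, Set.range_id, mfderivWithin_univ] at this
  exact DFunLike.congr_fun this v

theorem chartDeriv_apply (x : M) (X : VecField E M) :
    chartDeriv x (X x) = pullField x X (extChartAt 𝓘(ℝ, E) x x) := by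
  have h := chartSymmDeriv_pullField x X (mem_extChartAt_target x)
  have h2 := mfderiv_extChartAt_chartSymmDeriv x (mem_extChartAt_target x)
    (pullField x X (extChartAt 𝓘(ℝ, E) x x))
  -- The point obtained from `x` by the chart and its inverse equals `x` only propositionally;
  -- quantifying over `z` avoids transporting tangent vectors between fibres.
  have h3 : ∀ z, z = x → mfderiv 𝓘(ℝ, E) 𝓘(ℝ, E) (extChartAt 𝓘(ℝ, E) x) z (X z) =
      chartDeriv x (X x) := by rintro _ rfl; rfl
  rw [← h3 _ (extChartAt_to_inv (I := 𝓘(ℝ, E)) x), ← h]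
  exact h2

theorem chartDeriv_mlieBracket (x : M) (X Y : VecField E M) :
    chartDeriv x (mlieBracket 𝓘(ℝ, E) X Y x) =
      lieBracket ℝ (pullField x X) (pullField x Y) (extChartAt 𝓘(ℝ, E) x x) := by
  rw [← lieBracketWithin_univ, ← mpullbackWithin_eq_pullField, ← mpullbackWithin_eq_pullField]
  have : (Set.univ : Set E) = (extChartAt 𝓘(ℝ, E) x).symm ⁻¹' Set.univ ∩ Set.range 𝓘(ℝ, E) := by
    simp
  rw [this]
  exact (isInvertible_chartDeriv x).self_apply_inverse _

theorem mdifferentiableAt_extChartAt_symm (x : M) {y : E}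
    (hy : y ∈ (extChartAt 𝓘(ℝ, E) x).target) :
    MDifferentiableAt 𝓘(ℝ, E) 𝓘(ℝ, E) (extChartAt 𝓘(ℝ, E) x).symm y := by
  have := mdifferentiableWithinAt_extChartAt_symm (I := 𝓘(ℝ, E)) hy
  simpa only [modelWithCornersSelf_coe, Set.range_id, mdifferentiableWithinAt_univ] using this

theorem fderiv_comp_extChartAt_symm {f : M → ℝ} (x : M) {y : E}
    (hy : y ∈ (extChartAt 𝓘(ℝ, E) x).target)
    (hf : MDiffAt f ((extChartAt 𝓘(ℝ, E) x).symm y)) (v : E) :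
    fderiv ℝ (f ∘ (extChartAt 𝓘(ℝ, E) x).symm) y v =
      mvfderiv 𝓘(ℝ, E) f ((extChartAt 𝓘(ℝ, E) x).symm y) (chartSymmDeriv x y v) := by
  have := mvfderiv_comp_apply y hf (mdifferentiableAt_extChartAt_symm x hy) v
  refine Eq.trans ?_ this
  rw [← mfderiv_eq_fderiv]
  rfl

theorem differentiableAt_comp_extChartAt_symm {f : M → ℝ} {x : M} (hf : MDiffAt f x) :
    DifferentiableAt ℝ (f ∘ (extChartAt 𝓘(ℝ, E) x).symm) (extChartAt 𝓘(ℝ, E) x x) := by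
  rw [← extChartAt_to_inv (I := 𝓘(ℝ, E)) x] at hf
  exact (hf.comp (extChartAt 𝓘(ℝ, E) x x)
    (mdifferentiableAt_extChartAt_symm x (mem_extChartAt_target x))).differentiableAt

theorem mvfderiv_eq_fderiv_pullField {f : M → ℝ} {x : M} (hf : MDiffAt f x) (X : VecField E M) :
    mvfderiv 𝓘(ℝ, E) f x (X x) =
      fderiv ℝ (f ∘ (extChartAt 𝓘(ℝ, E) x).symm) (extChartAt 𝓘(ℝ, E) x x)
        (pullField x X (extChartAt 𝓘(ℝ, E) x x)) := by
  rw [fderiv_comp_extChartAt_symm x (mem_extChartAt_target x) (by rwa [extChartAt_to_inv]),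
    chartSymmDeriv_pullField x X (mem_extChartAt_target x), extChartAt_to_inv]

/-- The pullback of a one-form to the model space by the inverse of the chart at `x`. -/
def pullForm (x : M) (α : OneForm E M) (y : E) : E →L[ℝ] ℝ :=
  (α ((extChartAt 𝓘(ℝ, E) x).symm y)).comp (chartSymmDeriv x y)

theorem pullForm_pullField (x : M) (α : OneForm E M) (X : VecField E M) {y : E}
    (hy : y ∈ (extChartAt 𝓘(ℝ, E) x).target) :
    pullForm x α y (pullField x X y) =
      α ((extChartAt 𝓘(ℝ, E) x).symm y) (X ((extChartAt 𝓘(ℝ, E) x).symm y)) := by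
  rw [pullForm, ContinuousLinearMap.comp_apply, chartSymmDeriv_pullField x X hy]

/-- The smoothness of the pairing of a one-form and a vector field. -/
theorem IsSmoothOneForm.contMDiffAt_apply {α : OneForm E M} (hα : IsSmoothOneForm α)
    {X : VecField E M} {x : M} {n : WithTop ℕ∞} (hn : n ≤ ∞)
    (hX : CMDiffAt n (T% X) x) : CMDiffAt n (fun y ↦ α y (X y)) x := by
  have h := ContMDiffAt.clm_bundle_apply ((hα x).of_le hn) hX
  exact (Bundle.contMDiffAt_totalSpace.1 h).2

theorem IsSmoothOneForm.mdifferentiableAt_apply {α : OneForm E M} (hα : IsSmoothOneForm α)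
    {X : VecField E M} {x : M} (hX : MDiffAt (T% X) x) : MDiffAt (fun y ↦ α y (X y)) x := by
  have h := MDifferentiableAt.clm_bundle_apply ((hα x).mdifferentiableAt (by simp)) hX
  exact ((mdifferentiableAt_totalSpace _ _).1 h).2

/-- Vectors constant in the trivialization at `x` are the coordinate fields of the chart, so
`FiberBundle.extend` supplies coordinate frames. -/
theorem trivializationAt_symm_eq_chartSymmDeriv (x : M) {y : E}
    (hy : y ∈ (extChartAt 𝓘(ℝ, E) x).target) (w : E) :
    (trivializationAt E (TangentSpace 𝓘(ℝ, E)) x).symm ((extChartAt 𝓘(ℝ, E) x).symm y) w =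
      chartSymmDeriv x y w := by
  have hy' : (extChartAt 𝓘(ℝ, E) x).symm y ∈ (chartAt E x).source := by
    have := (extChartAt 𝓘(ℝ, E) x).map_target hy
    rwa [extChartAt_source] at this
  have := TangentBundle.symmL_trivializationAt (I := 𝓘(ℝ, E)) (𝕜 := ℝ) hy'
  simp only [modelWithCornersSelf_coe, Set.range_id, mfderivWithin_univ] at this
  have h2 := DFunLike.congr_fun this w
  have h3 := (trivializationAt E (TangentSpace 𝓘(ℝ, E)) x).symmL_apply (R := ℝ)
    (b := (extChartAt 𝓘(ℝ, E) x).symm y) hy' w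
  rw [← h3]
  refine h2.trans ?_
  have h4 : ∀ z, z = y → mfderiv 𝓘(ℝ, E) 𝓘(ℝ, E) (extChartAt 𝓘(ℝ, E) x).symm z w =
      mfderiv 𝓘(ℝ, E) 𝓘(ℝ, E) (extChartAt 𝓘(ℝ, E) x).symm y w := by rintro _ rfl; rfl
  exact h4 _ ((extChartAt 𝓘(ℝ, E) x).right_inv hy)

/-- The coefficients of the pulled-back form are the pairings of `α` with coordinate fields, and
finitely many of them determine the form linearly. -/
theorem differentiableAt_pullForm {α : OneForm E M} (hα : IsSmoothOneForm α) (x : M) :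
    DifferentiableAt ℝ (pullForm x α) (extChartAt 𝓘(ℝ, E) x x) := by
  obtain ⟨b, Φ, hΦ⟩ := exists_clm_eq_apply E
  have hfun : pullForm x α = Φ ∘ fun y i ↦ pullForm x α y (b i) := by
    ext1 y
    exact hΦ _
  rw [hfun]
  refine Φ.differentiableAt.comp _ (differentiableAt_pi.mpr fun i ↦ ?_)
  have h := hα.mdifferentiableAt_apply (X := FiberBundle.extend E
    ((trivializationAt E (TangentSpace 𝓘(ℝ, E)) x).symm x (b i)))
    (FiberBundle.mdifferentiableAt_extend 𝓘(ℝ, E) E (x := x) _)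
  refine (differentiableAt_comp_extChartAt_symm h).congr_of_eventuallyEq ?_
  filter_upwards [extChartAt_target_mem_nhds (I := 𝓘(ℝ, E)) x] with y hy
  have hx : x ∈ (trivializationAt E (TangentSpace 𝓘(ℝ, E)) x).baseSet :=
    FiberBundle.mem_baseSet_trivializationAt' x
  simp only [Function.comp_apply, FiberBundle.extend, pullForm, ContinuousLinearMap.comp_apply]
  rw [Bundle.Trivialization.apply_mk_symm _ hx, trivializationAt_symm_eq_chartSymmDeriv x hy]

/-- The invariant formula holds in the model space for the pulled-back fields; derivatives, pairings
and brackets are all compatible with the pullback by the chart. -/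
theorem extDerivOneForm_apply {α : OneForm E M} (hα : IsSmoothOneForm α) {x : M}
    {X Y : VecField E M} (hX : MDiffAt (T% X) x) (hY : MDiffAt (T% Y) x) :
    extDerivOneForm α x ![X x, Y x] =
      mvfderiv 𝓘(ℝ, E) (fun y ↦ α y (Y y)) x (X x) - mvfderiv 𝓘(ℝ, E) (fun y ↦ α y (X y)) x (Y x)
        - α x (mlieBracket 𝓘(ℝ, E) X Y x) := by
  set p := extChartAt 𝓘(ℝ, E) x x with hp
  have hpt : ∀ᶠ y in 𝓝 p, y ∈ (extChartAt 𝓘(ℝ, E) x).target :=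
    extChartAt_target_mem_nhds (I := 𝓘(ℝ, E)) x
  have hsub (Z : VecField E M) :
      (fun y ↦ pullForm x α y (pullField x Z y)) =ᶠ[𝓝 p]
        (fun y ↦ α y (Z y)) ∘ (extChartAt 𝓘(ℝ, E) x).symm := by
    filter_upwards [hpt] with y hy
    exact pullForm_pullField x α Z hy
  let β := fun y ↦ ContinuousAlternatingMap.ofSubsingleton ℝ E ℝ (0 : Fin 1) (pullForm x α y)
  have hβ : DifferentiableAt ℝ β p :=
    ((ContinuousAlternatingMap.ofSubsingletonLIE (𝕜 := ℝ) (E := E) (F := ℝ)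
      (0 : Fin 1)).toContinuousLinearEquiv.differentiableAt).comp p (differentiableAt_pullForm hα x)
  have key := extDeriv_apply_vectorField (V := ![pullField x X, pullField x Y]) hβ
    (by intro i; fin_cases i
        · exact differentiableAt_pullField hX
        · exact differentiableAt_pullField hY)
  have h1 : extDerivOneForm α x ![X x, Y x] =
      extDeriv β p (fun i ↦ ![pullField x X, pullField x Y] i p) := by
    change extDeriv β p (fun i ↦ chartDeriv x (![X x, Y x] i)) = _
    congr 1
    ext i
    fin_cases i
    · exact chartDeriv_apply x X
    · exact chartDeriv_apply x Y
  rw [h1, key]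
  have hβa (y : E) (v : Fin 1 → E) : β y v = pullForm x α y (v 0) := rfl
  simp only [hβa, Fin.sum_univ_two, Fin.removeNth]
  simp
  have h2 := pullForm_pullField x α (mlieBracket 𝓘(ℝ, E) X Y) (mem_extChartAt_target x)
  rw [← chartDeriv_apply, chartDeriv_mlieBracket, extChartAt_to_inv] at h2
  rw [mvfderiv_eq_fderiv_pullField (hα.mdifferentiableAt_apply hX),
    mvfderiv_eq_fderiv_pullField (hα.mdifferentiableAt_apply hY), ← (hsub X).fderiv_eq,
    ← (hsub Y).fderiv_eq, ← h2]
  ring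

theorem contDiffAt_comp_extChartAt_symm {f : M → ℝ} {x : M} {n : WithTop ℕ∞}
    (hf : CMDiffAt n f x) :
    ContDiffAt ℝ n (f ∘ (extChartAt 𝓘(ℝ, E) x).symm) (extChartAt 𝓘(ℝ, E) x x) := by
  have h := (contMDiffAt_iff.1 hf).2
  rw [← contDiffWithinAt_univ]
  simpa [Function.comp_def, chartAt_self_eq] using h

theorem eventuallyEq_comp_extChartAt (f : M → ℝ) (x : M) :
    f =ᶠ[𝓝 x] (f ∘ (extChartAt 𝓘(ℝ, E) x).symm) ∘ extChartAt 𝓘(ℝ, E) x := by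
  filter_upwards [extChartAt_source_mem_nhds (I := 𝓘(ℝ, E)) x] with y hy
  simp only [Function.comp_apply, (extChartAt 𝓘(ℝ, E) x).left_inv hy]

theorem mdifferentiableAt_of_comp_extChartAt_symm {f : M → ℝ} {x : M}
    (hf : DifferentiableAt ℝ (f ∘ (extChartAt 𝓘(ℝ, E) x).symm) (extChartAt 𝓘(ℝ, E) x x)) :
    MDiffAt f x :=
  (hf.mdifferentiableAt.comp x (mdifferentiableAt_extChartAt (mem_chart_source E x)))
    |>.congr_of_eventuallyEq (eventuallyEq_comp_extChartAt f x)

theorem eventually_fderiv_comp_extChartAt_symm {f : M → ℝ} {x : M} (hf : CMDiffAt 2 f x)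
    (Z : VecField E M) :
    (fun y ↦ mvfderiv 𝓘(ℝ, E) f y (Z y)) ∘ (extChartAt 𝓘(ℝ, E) x).symm
      =ᶠ[𝓝 (extChartAt 𝓘(ℝ, E) x x)]
        fun y ↦ fderiv ℝ (f ∘ (extChartAt 𝓘(ℝ, E) x).symm) y (pullField x Z y) := by
  have hfe : ∀ᶠ y in 𝓝 x, MDiffAt f y := by
    filter_upwards [(contMDiffAt_iff_contMDiffAt_nhds (by simp)).1 hf] with y hy
    exact ContMDiffAt.mdifferentiableAt hy (by simp)
  have hc : ∀ᶠ y in 𝓝 (extChartAt 𝓘(ℝ, E) x x),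
      MDiffAt f ((extChartAt 𝓘(ℝ, E) x).symm y) := by
    have := (continuousAt_extChartAt_symm (I := 𝓘(ℝ, E)) x).tendsto
    rw [extChartAt_to_inv] at this
    exact this.eventually hfe
  filter_upwards [extChartAt_target_mem_nhds (I := 𝓘(ℝ, E)) x, hc] with y hy hfy
  rw [fderiv_comp_extChartAt_symm x hy hfy, chartSymmDeriv_pullField x Z hy]
  rfl

theorem differentiableAt_fderiv_comp_extChartAt_symm {f : M → ℝ} {x : M} (hf : CMDiffAt 2 f x) :
    DifferentiableAt ℝ (fderiv ℝ (f ∘ (extChartAt 𝓘(ℝ, E) x).symm)) (extChartAt 𝓘(ℝ, E) x x) :=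
  ((contDiffAt_comp_extChartAt_symm hf).fderiv_right (m := 1) (by norm_num)).differentiableAt
    one_ne_zero

theorem mdifferentiableAt_mvfderiv_apply {f : M → ℝ} {x : M} (hf : CMDiffAt 2 f x)
    {Z : VecField E M} (hZ : MDiffAt (T% Z) x) :
    MDiffAt (fun y ↦ mvfderiv 𝓘(ℝ, E) f y (Z y)) x :=
  mdifferentiableAt_of_comp_extChartAt_symm
    (((differentiableAt_fderiv_comp_extChartAt_symm hf).clm_apply
      (differentiableAt_pullField hZ)).congr_of_eventuallyEq
        (eventually_fderiv_comp_extChartAt_symm hf Z))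

/-- The Lie bracket is the commutator of derivations. -/
theorem mvfderiv_mlieBracket {f : M → ℝ} {x : M} (hf : CMDiffAt 2 f x) {X Y : VecField E M}
    (hX : MDiffAt (T% X) x) (hY : MDiffAt (T% Y) x) :
    mvfderiv 𝓘(ℝ, E) f x (mlieBracket 𝓘(ℝ, E) X Y x) =
      mvfderiv 𝓘(ℝ, E) (fun y ↦ mvfderiv 𝓘(ℝ, E) f y (Y y)) x (X x) -
        mvfderiv 𝓘(ℝ, E) (fun y ↦ mvfderiv 𝓘(ℝ, E) f y (X y)) x (Y x) := by
  set p := extChartAt 𝓘(ℝ, E) x x with hp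
  set F := f ∘ (extChartAt 𝓘(ℝ, E) x).symm with hF
  have hFc : ContDiffAt ℝ 2 F p := contDiffAt_comp_extChartAt_symm hf
  have hdd (Z W : VecField E M) (hZ : MDiffAt (T% Z) x) :
      mvfderiv 𝓘(ℝ, E) (fun y ↦ mvfderiv 𝓘(ℝ, E) f y (Z y)) x (W x) =
        fderiv ℝ (fderiv ℝ F) p (pullField x W p) (pullField x Z p) +
          fderiv ℝ F p (fderiv ℝ (pullField x Z) p (pullField x W p)) := by
    rw [mvfderiv_eq_fderiv_pullField (mdifferentiableAt_mvfderiv_apply hf hZ) W,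
      (eventually_fderiv_comp_extChartAt_symm hf Z).fderiv_eq,
      fderiv_clm_apply (differentiableAt_fderiv_comp_extChartAt_symm hf)
        (differentiableAt_pullField hZ)]
    simp [add_comm]
    rfl
  rw [hdd Y X hY, hdd X Y hX, mvfderiv_eq_fderiv_pullField (hf.mdifferentiableAt (by simp)),
    ← chartDeriv_apply, chartDeriv_mlieBracket, lieBracket, map_sub]
  -- Symmetry of the second derivative cancels the second-order terms, leaving `fderiv F` applied to
  -- the bracket.
  have := (hFc.isSymmSndFDerivAt (by simp)).eq (pullField x X p) (pullField x Y p)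
  rw [this]
  ring

theorem mvfderiv_congr {E' : Type*} [NormedAddCommGroup E'] [NormedSpace ℝ E']
    {L : Type*} [TopologicalSpace L] [ChartedSpace E' L] {f g : L → ℝ} {x : L}
    (h : f =ᶠ[𝓝 x] g) : mvfderiv 𝓘(ℝ, E') f x = mvfderiv 𝓘(ℝ, E') g x := by
  ext v
  have := h.mfderiv_eq (I := 𝓘(ℝ, E')) (I' := 𝓘(ℝ, ℝ))
  exact DFunLike.congr_fun this v

theorem eventually_mdifferentiableAt {X : VecField E M} {x : M} (hX : CMDiffAt 2 (T% X) x) :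
    ∀ᶠ y in 𝓝 x, MDiffAt (T% X) y := by
  filter_upwards [(contMDiffAt_iff_contMDiffAt_nhds (by simp)).1 hX] with y hy
  exact ContMDiffAt.mdifferentiableAt hy (by simp)

theorem mdifferentiableAt_mlieBracket {X Y : VecField E M} {x : M} (hX : CMDiffAt 2 (T% X) x)
    (hY : CMDiffAt 2 (T% Y) x) : MDiffAt (T% (mlieBracket 𝓘(ℝ, E) X Y)) x := by
  have : CompleteSpace E := FiniteDimensional.complete ℝ E
  have : IsManifold 𝓘(ℝ, E) (((2 : ℕ∞) : WithTop ℕ∞) + 1) M :=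
    IsManifold.of_le (n := ∞) (by norm_cast)
  have : IsManifold 𝓘(ℝ, E) (minSmoothness ℝ 2) M :=
    IsManifold.of_le (n := ∞) (by simp [minSmoothness]; norm_cast)
  have : IsManifold 𝓘(ℝ, E) (minSmoothness ℝ 3) M :=
    IsManifold.of_le (n := ∞) (by simp [minSmoothness]; norm_cast)
  exact (ContMDiffAt.mlieBracket_vectorField (m := 1) (n := 2) hX hY
    (by simp [minSmoothness]; norm_num)).mdifferentiableAt (by simp)

/-- If `i_N dα = 0`, then `dα` is invariant under the flow of `N`: this is the formula for the
Lie derivative `L_N dα = 0`. -/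
theorem mvfderiv_extDerivOneForm_of_contract_eq_zero {α : OneForm E M} (hα : IsSmoothOneForm α)
    {x : M} {N X Y : VecField E M} (hN : CMDiffAt 2 (T% N) x) (hX : CMDiffAt 2 (T% X) x)
    (hY : CMDiffAt 2 (T% Y) x) (hker : ∀ᶠ y in 𝓝 x, ∀ v, extDerivOneForm α y ![N y, v] = 0) :
    mvfderiv 𝓘(ℝ, E) (fun y ↦ extDerivOneForm α y ![X y, Y y]) x (N x) =
      extDerivOneForm α x ![mlieBracket 𝓘(ℝ, E) N X x, Y x] +
        extDerivOneForm α x ![X x, mlieBracket 𝓘(ℝ, E) N Y x] := by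
  have : CompleteSpace E := FiniteDimensional.complete ℝ E
  have h2 : (2 : WithTop ℕ∞) ≤ ∞ := by norm_cast
  have dN := hN.mdifferentiableAt (by simp)
  have dX := hX.mdifferentiableAt (by simp)
  have dY := hY.mdifferentiableAt (by simp)
  have aN := hα.contMDiffAt_apply h2 hN
  have aX := hα.contMDiffAt_apply h2 hX
  have aY := hα.contMDiffAt_apply h2 hY
  have bXY := mdifferentiableAt_mlieBracket hX hY
  have bNX := mdifferentiableAt_mlieBracket hN hX
  have bNY := mdifferentiableAt_mlieBracket hN hY
  have e1 : (fun y ↦ extDerivOneForm α y ![X y, Y y]) =ᶠ[𝓝 x]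
      ((fun y ↦ mvfderiv 𝓘(ℝ, E) (fun z ↦ α z (Y z)) y (X y)) -
        (fun y ↦ mvfderiv 𝓘(ℝ, E) (fun z ↦ α z (X z)) y (Y y))) -
          (fun y ↦ α y (mlieBracket 𝓘(ℝ, E) X Y y)) := by
    filter_upwards [eventually_mdifferentiableAt hX, eventually_mdifferentiableAt hY] with y h1 h2
    exact extDerivOneForm_apply hα h1 h2
  -- The condition `i_N dα = 0` in the form N(α(W)) = W(α(N)) + α([N, W]). It holds near `x`, so it
  -- may be differentiated once more in `c2`.
  have e2 (W : VecField E M) (hW : CMDiffAt 2 (T% W) x) :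
      (fun y ↦ mvfderiv 𝓘(ℝ, E) (fun z ↦ α z (W z)) y (N y)) =ᶠ[𝓝 x]
        (fun y ↦ mvfderiv 𝓘(ℝ, E) (fun z ↦ α z (N z)) y (W y)) +
          (fun y ↦ α y (mlieBracket 𝓘(ℝ, E) N W y)) := by
    filter_upwards [eventually_mdifferentiableAt hN, eventually_mdifferentiableAt hW, hker]
      with y h1 h2 h3
    have := extDerivOneForm_apply hα h1 h2
    rw [h3] at this
    simp only [Pi.add_apply]
    linarith
  have c1 : mvfderiv 𝓘(ℝ, E) (fun y ↦ extDerivOneForm α y ![X y, Y y]) x (N x) =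
      mvfderiv 𝓘(ℝ, E) (fun y ↦ mvfderiv 𝓘(ℝ, E) (fun z ↦ α z (Y z)) y (X y)) x (N x) -
      mvfderiv 𝓘(ℝ, E) (fun y ↦ mvfderiv 𝓘(ℝ, E) (fun z ↦ α z (X z)) y (Y y)) x (N x) -
      mvfderiv 𝓘(ℝ, E) (fun y ↦ α y (mlieBracket 𝓘(ℝ, E) X Y y)) x (N x) := by
    have hXY := mdifferentiableAt_mvfderiv_apply aY dX
    have hYX := mdifferentiableAt_mvfderiv_apply aX dY
    rw [mvfderiv_congr e1, mvfderiv_sub (hXY.sub hYX) (hα.mdifferentiableAt_apply bXY),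
      mvfderiv_sub hXY hYX]
    rfl
  have c2 (W V : VecField E M) (hW : CMDiffAt 2 (T% W) x) :
      mvfderiv 𝓘(ℝ, E) (fun y ↦ mvfderiv 𝓘(ℝ, E) (fun z ↦ α z (W z)) y (N y)) x (V x) =
      mvfderiv 𝓘(ℝ, E) (fun y ↦ mvfderiv 𝓘(ℝ, E) (fun z ↦ α z (N z)) y (W y)) x (V x) +
      mvfderiv 𝓘(ℝ, E) (fun y ↦ α y (mlieBracket 𝓘(ℝ, E) N W y)) x (V x) := by
    rw [mvfderiv_congr (e2 W hW), mvfderiv_add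
      (mdifferentiableAt_mvfderiv_apply aN (hW.mdifferentiableAt (by simp)))
      (hα.mdifferentiableAt_apply (mdifferentiableAt_mlieBracket hN hW))]
    rfl
  have k1 := mvfderiv_mlieBracket aY dN dX
  have k2 := mvfderiv_mlieBracket aX dN dY
  have k3 := mvfderiv_mlieBracket aN dX dY
  have k4 := extDerivOneForm_apply hα dN bXY
  rw [hker.self_of_nhds] at k4
  have k5 := extDerivOneForm_apply hα bNX dY
  have k6 := extDerivOneForm_apply hα dX bNY
  have : IsManifold 𝓘(ℝ, E) (minSmoothness ℝ 3) M :=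
    IsManifold.of_le (n := ∞) (by simp [minSmoothness]; norm_cast)
  -- The Jacobi identity for `N, X, Y`. With the commutators `k1`, `k2`, `k3` and dα(N, [X, Y]) = 0
  -- from `k4`, it plays the role of d(dα) = 0.
  have k7 := leibniz_identity_mlieBracket_apply (U := N) (V := X) (W := Y) (x := x)
    (by simpa [minSmoothness] using hN) (by simpa [minSmoothness] using hX)
    (by simpa [minSmoothness] using hY)
  rw [k7, map_add] at k4
  rw [c1, k5, k6, k1, k2, c2 Y X hY, c2 X Y hX]
  linarith

end Calculus
end ContactPair

/-! ### Smoothness of derivatives, brackets and determinants. -/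

namespace ContactPair

section Smoothness

open VectorField

variable {E : Type*} [NormedAddCommGroup E] [NormedSpace ℝ E] [FiniteDimensional ℝ E]
  {M : Type*} [TopologicalSpace M] [ChartedSpace E M] [IsManifold 𝓘(ℝ, E) ∞ M]

theorem contMDiffAt_of_comp_extChartAt_symm {f : M → ℝ} {x : M} {n : WithTop ℕ∞} (hn : n ≤ ∞)
    (hf : ContDiffAt ℝ n (f ∘ (extChartAt 𝓘(ℝ, E) x).symm) (extChartAt 𝓘(ℝ, E) x x)) :
    CMDiffAt n f x :=
  (hf.contMDiffAt.comp x ((contMDiffAt_extChartAt (n := ∞)).of_le hn))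
    |>.congr_of_eventuallyEq (eventuallyEq_comp_extChartAt f x)

theorem contDiffAt_pullField {x : M} {X : VecField E M} (hX : CMDiffAt ∞ (T% X) x) :
    ContDiffAt ℝ ∞ (pullField x X) (extChartAt 𝓘(ℝ, E) x x) := by
  have : CompleteSpace E := FiniteDimensional.complete ℝ E
  have h := contMDiffWithinAt_mpullbackWithin_extChartAt_symm (I := 𝓘(ℝ, E)) (m := ∞) (n := ∞)
    (s := Set.univ) (x := x) (V := X) hX.contMDiffWithinAt uniqueMDiffOn_univ (Set.mem_univ _)
    (by simp)
  rw [mpullbackWithin_eq_pullField, Set.preimage_univ, Set.inter_univ] at h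
  have h2 := (contMDiff_snd_tangentBundle_modelSpace (n := ∞) E 𝓘(ℝ, E)).contMDiffAt
    |>.comp_contMDiffWithinAt _ h
  exact (h2.contMDiffAt (extChartAt_target_mem_nhds (I := 𝓘(ℝ, E)) x)).contDiffAt

theorem contMDiffAt_mvfderiv_apply {f : M → ℝ} {x : M} (hf : CMDiffAt ∞ f x)
    {Z : VecField E M} (hZ : CMDiffAt ∞ (T% Z) x) :
    CMDiffAt ∞ (fun y ↦ mvfderiv 𝓘(ℝ, E) f y (Z y)) x :=
  contMDiffAt_of_comp_extChartAt_symm le_rfl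
    ((((contDiffAt_comp_extChartAt_symm hf).fderiv_right (m := ∞) (by simp)).clm_apply
      (contDiffAt_pullField hZ)).congr_of_eventuallyEq
        (eventually_fderiv_comp_extChartAt_symm (hf.of_le (by norm_cast)) Z))

theorem contMDiffAt_mlieBracket {X Y : VecField E M} {x : M} (hX : CMDiffAt ∞ (T% X) x)
    (hY : CMDiffAt ∞ (T% Y) x) : CMDiffAt ∞ (T% (mlieBracket 𝓘(ℝ, E) X Y)) x := by
  have : CompleteSpace E := FiniteDimensional.complete ℝ E
  have : IsManifold 𝓘(ℝ, E) (((⊤ : ℕ∞) : WithTop ℕ∞) + 1) M :=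
    IsManifold.of_le (n := ∞) (by norm_cast)
  have : IsManifold 𝓘(ℝ, E) (minSmoothness ℝ 2) M :=
    IsManifold.of_le (n := ∞) (by simp [minSmoothness]; norm_cast)
  have : IsManifold 𝓘(ℝ, E) (minSmoothness ℝ 3) M :=
    IsManifold.of_le (n := ∞) (by simp [minSmoothness]; norm_cast)
  exact ContMDiffAt.mlieBracket_vectorField (m := ⊤) (n := ⊤) hX hY (by simp [minSmoothness])

theorem IsSmoothOneForm.contMDiffAt_extDeriv_apply {α : OneForm E M} (hα : IsSmoothOneForm α)
    {X Y : VecField E M} {x : M} (hX : CMDiffAt ∞ (T% X) x) (hY : CMDiffAt ∞ (T% Y) x) :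
    CMDiffAt ∞ (fun y ↦ extDerivOneForm α y ![X y, Y y]) x := by
  have e1 : (fun y ↦ extDerivOneForm α y ![X y, Y y]) =ᶠ[𝓝 x]
      ((fun y ↦ mvfderiv 𝓘(ℝ, E) (fun z ↦ α z (Y z)) y (X y)) -
        (fun y ↦ mvfderiv 𝓘(ℝ, E) (fun z ↦ α z (X z)) y (Y y))) -
          (fun y ↦ α y (mlieBracket 𝓘(ℝ, E) X Y y)) := by
    filter_upwards [eventually_mdifferentiableAt (hX.of_le (by norm_cast)),
      eventually_mdifferentiableAt (hY.of_le (by norm_cast))] with y h1 h2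
    exact extDerivOneForm_apply hα h1 h2
  refine ContMDiffAt.congr_of_eventuallyEq ?_ e1
  exact ((contMDiffAt_mvfderiv_apply (hα.contMDiffAt_apply le_rfl hY) hX).sub
    (contMDiffAt_mvfderiv_apply (hα.contMDiffAt_apply le_rfl hX) hY)).sub
      (hα.contMDiffAt_apply le_rfl (contMDiffAt_mlieBracket hX hY))

theorem contMDiffAt_det {ι : Type*} [Fintype ι] [DecidableEq ι] {A : M → Matrix ι ι ℝ} {x : M}
    (hA : ∀ i j, CMDiffAt ∞ (fun y ↦ A y i j) x) : CMDiffAt ∞ (fun y ↦ (A y).det) x := by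
  simp only [Matrix.det_apply']
  exact contMDiffAt_finsetSum fun σ _ ↦
    contMDiffAt_const.mul (contMDiffAt_finsetProd fun i _ ↦ hA _ _)

end Smoothness

/-! ### Smoothness of metric duals. -/

section Riesz

variable {E : Type*} [NormedAddCommGroup E] [NormedSpace ℝ E] [FiniteDimensional ℝ E]
  {M : Type*} [TopologicalSpace M] [ChartedSpace E M] [IsManifold 𝓘(ℝ, E) ∞ M]
  [Bundle.RiemannianBundle (fun x : M ↦ TangentSpace 𝓘(ℝ, E) x)]
  [IsContMDiffRiemannianBundle 𝓘(ℝ, E) ∞ E (fun x : M ↦ TangentSpace 𝓘(ℝ, E) x)]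

theorem contMDiffAt_inner {X Y : VecField E M} {x : M} (hX : CMDiffAt ∞ (T% X) x)
    (hY : CMDiffAt ∞ (T% Y) x) : CMDiffAt ∞ (fun y ↦ inner ℝ (X y) (Y y)) x :=
  ContMDiffAt.inner_bundle (E := fun x : M ↦ TangentSpace 𝓘(ℝ, E) x) (b := fun x ↦ x) hX hY

/-- A vector field whose inner products with smooth vector fields are smooth is smooth. -/
theorem contMDiffAt_of_inner {W : VecField E M} {x : M}
    (h : ∀ S : VecField E M, CMDiffAt ∞ (T% S) x → CMDiffAt ∞ (fun y ↦ inner ℝ (S y) (W y)) x) :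
    CMDiffAt ∞ (T% W) x := by
  set t := trivializationAt E (TangentSpace 𝓘(ℝ, E)) x with ht
  have hx : x ∈ t.baseSet := FiberBundle.mem_baseSet_trivializationAt' x
  let b := Module.finBasis ℝ E
  let s := t.localFrame b
  have hs (i) : CMDiffAt ∞ (T% (s i)) x := contMDiffAt_localFrame_of_mem ∞ t b i hx
  let G (y : M) : Matrix (Fin (Module.finrank ℝ E)) (Fin (Module.finrank ℝ E)) ℝ :=
    fun i j ↦ inner ℝ (s i y) (s j y)
  let A (i) (y : M) := (G y).updateCol i fun j ↦ inner ℝ (s j y) (W y)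
  have hG (i j) : CMDiffAt ∞ (fun y ↦ G y i j) x := contMDiffAt_inner (hs i) (hs j)
  have hA (i j k) : CMDiffAt ∞ (fun y ↦ A i y j k) x := by
    by_cases hk : k = i
    · simpa [A, Matrix.updateCol_apply, hk] using h _ (hs j)
    · simpa [A, Matrix.updateCol_apply, hk] using hG j k
  -- Cramer's rule for the Gram matrix `G` of the local frame: each coefficient of `W` becomes a
  -- quotient of determinants with smooth entries.
  have hcoeff (y : M) (hy : y ∈ t.baseSet) (i) :
      (G y).det * t.localFrameCoeff 𝓘(ℝ, E) b i y (W y) = (A i y).det := by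
    have h1 := t.eq_sum_localFrameCoeff_smul (I := 𝓘(ℝ, E)) (b := b) (s := W) hy
    have h2 : (fun j ↦ inner ℝ (s j y) (W y)) =
        (G y).mulVec fun i ↦ t.localFrameCoeff 𝓘(ℝ, E) b i y (W y) := by
      ext j
      conv_lhs => rw [h1]
      simp only [inner_sum, inner_smul_right, Matrix.mulVec, dotProduct, G]
      exact Finset.sum_congr rfl fun k _ ↦ mul_comm _ _
    change _ = ((G y).updateCol i fun j ↦ inner ℝ (s j y) (W y)).det
    rw [h2, ← Matrix.cramer_apply, Matrix.cramer_eq_adjugate_mulVec, Matrix.mulVec_mulVec,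
      Matrix.adjugate_mul, Matrix.smul_mulVec, Matrix.one_mulVec]
    rfl
  have hdet : ∀ y ∈ t.baseSet, (G y).det ≠ 0 := by
    intro y hy
    have hli : LinearIndependent ℝ fun i ↦ s i y := by
      have hb : (fun i ↦ s i y) = t.basisAt b hy :=
        funext fun i ↦ t.localFrame_apply_of_mem_baseSet b hy
      rw [hb]
      exact (t.basisAt b hy).linearIndependent
    exact Matrix.det_gram_ne_zero_iff_linearIndependent.mpr hli
  rw [contMDiffAt_iff_localFrameCoeff (b := b) hx]
  intro i
  refine ((contMDiffAt_det (hA i)).mul ((contMDiffAt_det hG).inv₀ (hdet x hx)))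
    |>.congr_of_eventuallyEq ?_
  filter_upwards [t.open_baseSet.mem_nhds hx] with y hy
  simp only [Pi.mul_apply, ← hcoeff y hy i]
  change t.localFrameCoeff 𝓘(ℝ, E) b i y (W y) = _
  field_simp [hdet y hy]

end Riesz
end ContactPair

/-! ### The trace of a bilinear form over pairs `u, J u`. -/

namespace ContactPair

/-- The trace of a bilinear form `B` vanishes if `B(z, z) = 0` and `B(u, u) + B(J u, J u) = 0` for
`u ⊥ z`, where `J` is skew-symmetric and `J ^ 2 = -1` on the orthogonal complement of `z`. -/
theorem sum_bilin_eq_zero {V : Type*} [NormedAddCommGroup V] [InnerProductSpace ℝ V]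
    {ι : Type*} [Fintype ι] [DecidableEq ι] {e : ι → V} (he : Orthonormal ℝ e)
    (D : Submodule ℝ V) (heD : ∀ i, e i ∈ D) (hspan : ∀ u ∈ D, u = ∑ i, inner ℝ (e i) u • e i)
    (J : V →ₗ[ℝ] V) (hJD : ∀ u ∈ D, J u ∈ D) (hJ : ∀ u v, inner ℝ (J u) v = -inner ℝ u (J v))
    {z : V} (hz : z ∈ D) (hz1 : inner ℝ z z = (1 : ℝ)) (hJz : J z = 0)
    (hJJ : ∀ u ∈ D, J (J u) = -u + inner ℝ u z • z)
    (B : V →ₗ[ℝ] V →ₗ[ℝ] ℝ) (hBz : B z z = 0)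
    (hB : ∀ u ∈ D, inner ℝ u z = (0 : ℝ) → B u u + B (J u) (J u) = 0) :
    ∑ i, B (e i) (e i) = 0 := by
  set a : ι → ℝ := fun i ↦ inner ℝ (e i) z with ha
  have hza : z = ∑ i, a i • e i := hspan z hz
  -- `hB` applied to the component `e i - a i • z` of `e i` orthogonal to `z`.
  have h1 (i) : B (e i) (e i) - a i * (B (e i) z) - a i * B z (e i) + B (J (e i)) (J (e i)) = 0 := by
    have h := hB (e i - a i • z) (D.sub_mem (heD i) (D.smul_mem _ hz)) (by
      rw [inner_sub_left, real_inner_smul_left, hz1, ha]; simp)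
    simp only [map_sub, map_smul, LinearMap.sub_apply, LinearMap.smul_apply, hBz, hJz, smul_zero,
      sub_zero, smul_eq_mul, mul_zero] at h
    linarith
  have h2 : ∑ i, a i * B (e i) z = 0 := by
    have : B (∑ i, a i • e i) z = 0 := by rw [← hza, hBz]
    simpa only [map_sum, map_smul, LinearMap.sum_apply, LinearMap.smul_apply, smul_eq_mul] using this
  have h3 : ∑ i, a i * B z (e i) = 0 := by
    have : B z (∑ i, a i • e i) = 0 := by rw [← hza, hBz]
    simpa only [map_sum, map_smul, smul_eq_mul] using this
  -- The matrix of `J` times its transpose is `1 - a aᵀ`, the projection orthogonal to `z`. This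
  -- replaces the choice of a basis adapted to `J`.
  have h4 (j l) : ∑ i, inner ℝ (e j) (J (e i)) * inner ℝ (e l) (J (e i)) =
      (if j = l then 1 else 0) - a j * a l := by
    have hjl : inner ℝ (J (e j)) (J (e l)) = (if j = l then 1 else 0) - a j * a l := by
      rw [hJ, hJJ _ (heD l), inner_add_right, inner_neg_right, real_inner_smul_right,
        orthonormal_iff_ite.mp he]
      ring
    rw [← hjl]
    conv_rhs => rw [hspan _ (hJD _ (heD l))]
    rw [inner_sum]
    refine Finset.sum_congr rfl fun i _ ↦ ?_
    rw [real_inner_smul_right, real_inner_comm (J (e i)) (e j), hJ (e i) (e j),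
      real_inner_comm (J (e i)) (e l), hJ (e i) (e l), real_inner_comm (e i) (J (e j))]
    ring
  -- By `h4` the sum over `J (e i)` is the trace of `B` minus `B z z = 0`. Summing `h1` therefore
  -- gives twice the trace equal to zero.
  have h5 : ∑ i, B (J (e i)) (J (e i)) = ∑ i, B (e i) (e i) := by
    have h6 (i) : B (J (e i)) (J (e i)) =
        ∑ j, ∑ l, inner ℝ (e j) (J (e i)) * inner ℝ (e l) (J (e i)) * B (e j) (e l) := by
      conv_lhs => rw [hspan _ (hJD _ (heD i))]
      simp only [map_sum, map_smul, LinearMap.sum_apply, LinearMap.smul_apply, smul_eq_mul,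
        Finset.mul_sum]
      rw [Finset.sum_comm]
      refine Finset.sum_congr rfl fun j _ ↦ Finset.sum_congr rfl fun l _ ↦ ?_
      ring
    simp only [h6]
    rw [Finset.sum_comm]
    have h7 (j) : ∑ i, ∑ l, inner ℝ (e j) (J (e i)) * inner ℝ (e l) (J (e i)) * B (e j) (e l) =
        B (e j) (e j) - a j * B (e j) z := by
      rw [Finset.sum_comm]
      simp only [← Finset.sum_mul, h4, sub_mul, Finset.sum_sub_distrib]
      congr 1
      · simp
      · conv_rhs => rw [hza]
        simp only [map_sum, map_smul, smul_eq_mul, Finset.mul_sum, mul_assoc]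
    simp only [h7, Finset.sum_sub_distrib, h2, sub_zero]
  have h8 := Finset.sum_congr rfl fun i (_ : i ∈ Finset.univ) ↦ h1 i
  simp only [Finset.sum_add_distrib, Finset.sum_sub_distrib, h2, h3, h5, Finset.sum_const_zero] at h8
  linarith

/-! ### The orthogonal splitting of the tangent bundle and its smoothness. -/

section SplitMetricPair

open VectorField

variable {E : Type*} [NormedAddCommGroup E] [NormedSpace ℝ E] [FiniteDimensional ℝ E]
  {M : Type*} [TopologicalSpace M] [ChartedSpace E M] [IsManifold 𝓘(ℝ, E) ∞ M]
  [Bundle.RiemannianBundle (fun x : M ↦ TangentSpace 𝓘(ℝ, E) x)]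
  [IsContMDiffRiemannianBundle 𝓘(ℝ, E) ∞ E (fun x : M ↦ TangentSpace 𝓘(ℝ, E) x)]

/-- The data of a metric contact pair with decomposable `φ`, where the conditions on the powers of
`dα₁` and `dα₂` are replaced by their consequences for the characteristic distributions. -/
structure IsSplitMetricPair (α₁ α₂ : OneForm E M) (Z₁ Z₂ : VecField E M) (φ : EndField E M)
    (p₁ p₂ : ℕ) : Prop where
  smooth₁ : IsSmoothOneForm α₁
  smooth₂ : IsSmoothOneForm α₂
  smooth : IsSmoothEndField φ
  reeb : IsReebPair α₁ α₂ Z₁ Z₂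
  sq_apply : ∀ x v, φ x (φ x v) = -v + α₁ x v • Z₁ x + α₂ x v • Z₂ x
  apply_reeb₁ : ∀ x, φ x (Z₁ x) = 0
  apply_reeb₂ : ∀ x, φ x (Z₂ x) = 0
  inner_apply : ∀ (x : M) (u v : TangentSpace 𝓘(ℝ, E) x),
    inner ℝ u (φ x v) = (1 / 2 : ℝ) * (extDerivOneForm α₁ x ![u, v] + extDerivOneForm α₂ x ![u, v])
  inner_reeb₁ : ∀ (x : M) (u : TangentSpace 𝓘(ℝ, E) x), inner ℝ u (Z₁ x) = α₁ x u
  inner_reeb₂ : ∀ (x : M) (u : TangentSpace 𝓘(ℝ, E) x), inner ℝ u (Z₂ x) = α₂ x u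
  dec₁ : ∀ x, ∀ v ∈ charDist α₁ x, φ x v ∈ charDist α₁ x
  dec₂ : ∀ x, ∀ v ∈ charDist α₂ x, φ x v ∈ charDist α₂ x
  finrank₁ : ∀ x, Module.finrank ℝ (charDist α₁ x) = p₁
  finrank₂ : ∀ x, Module.finrank ℝ (charDist α₂ x) = p₂
  finrank_eq : Module.finrank ℝ E = p₁ + p₂

variable {α₁ α₂ : OneForm E M} {Z₁ Z₂ : VecField E M} {φ : EndField E M}

theorem IsMetricContactPair.isSplitMetricPair {h k : ℕ}
    (H : IsMetricContactPair h k α₁ α₂ Z₁ Z₂ φ) (hdec : IsDecomposable α₁ α₂ φ) :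
    IsSplitMetricPair α₁ α₂ Z₁ Z₂ φ (2 * k + 1) (2 * h + 1) where
  smooth₁ := H.contactPair.smooth₁
  smooth₂ := H.contactPair.smooth₂
  smooth := H.smooth
  reeb := H.reeb
  sq_apply := H.sq_apply
  apply_reeb₁ := H.apply_reeb₁
  apply_reeb₂ := H.apply_reeb₂
  inner_apply := H.inner_apply
  inner_reeb₁ := H.inner_reeb₁
  inner_reeb₂ := H.inner_reeb₂
  dec₁ := hdec.1
  dec₂ := hdec.2
  finrank₁ x := (H.contactPair.finrank_charDist x).1
  finrank₂ x := (H.contactPair.finrank_charDist x).2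
  finrank_eq := by rw [H.contactPair.finrank_eq]; ring

namespace IsSplitMetricPair

variable {p₁ p₂ : ℕ}

/-- The structure does not distinguish the two indices, so every result on the first characteristic
distribution also serves for the second. -/
theorem symm (H : IsSplitMetricPair α₁ α₂ Z₁ Z₂ φ p₁ p₂) :
    IsSplitMetricPair α₂ α₁ Z₂ Z₁ φ p₂ p₁ where
  smooth₁ := H.smooth₂
  smooth₂ := H.smooth₁
  smooth := H.smooth
  reeb :=
    { smooth₁ := H.reeb.smooth₂
      smooth₂ := H.reeb.smooth₁
      apply₁₁ := H.reeb.apply₂₂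
      apply₂₂ := H.reeb.apply₁₁
      apply₁₂ := H.reeb.apply₂₁
      apply₂₁ := H.reeb.apply₁₂
      contract₁₁ := H.reeb.contract₂₂
      contract₂₁ := H.reeb.contract₁₂
      contract₁₂ := H.reeb.contract₂₁
      contract₂₂ := H.reeb.contract₁₁ }
  sq_apply x v := by rw [H.sq_apply, add_right_comm]
  apply_reeb₁ := H.apply_reeb₂
  apply_reeb₂ := H.apply_reeb₁
  inner_apply x u v := by rw [H.inner_apply, add_comm]
  inner_reeb₁ := H.inner_reeb₂
  inner_reeb₂ := H.inner_reeb₁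
  dec₁ := H.dec₂
  dec₂ := H.dec₁
  finrank₁ := H.finrank₂
  finrank₂ := H.finrank₁
  finrank_eq := by rw [H.finrank_eq, add_comm]

variable (H : IsSplitMetricPair α₁ α₂ Z₁ Z₂ φ p₁ p₂)
include H

theorem reeb₂_mem (x : M) : Z₂ x ∈ charDist α₁ x :=
  mem_charDist_iff.mpr ⟨H.reeb.apply₁₂ x, curryLeft_eq_zero_iff.mp (H.reeb.contract₁₂ x)⟩

theorem inner_map_left (x : M) (u v : TangentSpace 𝓘(ℝ, E) x) :
    inner ℝ (φ x u) v = (-inner ℝ u (φ x v) : ℝ) := by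
  rw [real_inner_comm, H.inner_apply, H.inner_apply, apply_swap _ u v, apply_swap _ u v]
  ring

/-- `v` lies in the kernel of dα₁, so only dα₂ survives. This ties the metric along the first
distribution to a form that is invariant under sections of the second. -/
theorem inner_map_of_mem {x : M} {u v : TangentSpace 𝓘(ℝ, E) x} (hv : v ∈ charDist α₁ x) :
    inner ℝ u (φ x v) = (1 / 2 : ℝ) * extDerivOneForm α₂ x ![u, v] := by
  rw [H.inner_apply, apply_swap _ v u, (mem_charDist_iff.mp hv).2]
  ring

theorem sq_apply_of_mem {x : M} {v : TangentSpace 𝓘(ℝ, E) x} (hv : v ∈ charDist α₁ x) :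
    φ x (φ x v) = -v + α₂ x v • Z₂ x := by
  rw [H.sq_apply, (mem_charDist_iff.mp hv).1, zero_smul, add_zero]

/-- Up to a multiple of `Z₁`, which is orthogonal to `u`, the vector `v` is -φ(φ v). Pairing `u`
with φ(φ v) gives dα₁(u, φ v) and dα₂(u, φ v): the first vanishes because of `u`, the second because
decomposability keeps φ v in the kernel of dα₂. -/
theorem inner_eq_zero {x : M} {u v : TangentSpace 𝓘(ℝ, E) x} (hu : u ∈ charDist α₁ x)
    (hv : v ∈ charDist α₂ x) : inner ℝ u v = (0 : ℝ) := by
  have h1 := H.symm.sq_apply_of_mem hv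
  have h2 : inner ℝ u (φ x (φ x v)) = (0 : ℝ) := by
    rw [H.inner_apply, (mem_charDist_iff.mp hu).2, apply_swap,
      (mem_charDist_iff.mp (H.dec₂ x v hv)).2]
    ring
  rw [h1, inner_add_right, inner_neg_right, real_inner_smul_right, H.inner_reeb₁,
    (mem_charDist_iff.mp hu).1] at h2
  linarith

/-- Orthogonality gives one inclusion, and the ranks add up to the dimension. -/
theorem orthogonal_eq (x : M) : (charDist α₁ x)ᗮ = charDist α₂ x := by
  symm
  refine Submodule.eq_of_le_of_finrank_eq (fun v hv ↦ ?_) ?_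
  · rw [Submodule.mem_orthogonal]
    exact fun u hu ↦ H.inner_eq_zero hu hv
  · have h1 := (charDist α₁ x).finrank_add_finrank_orthogonal
    have h2 : Module.finrank ℝ (TangentSpace 𝓘(ℝ, E) x) = p₁ + p₂ := H.finrank_eq
    rw [H.finrank₁] at h1
    rw [H.finrank₂]
    omega

theorem starProjection_mem (x : M) (v : TangentSpace 𝓘(ℝ, E) x) :
    (charDist α₁ x).starProjection v ∈ charDist α₁ x :=
  Submodule.starProjection_apply_mem _ _

theorem sub_starProjection_mem (x : M) (v : TangentSpace 𝓘(ℝ, E) x) :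
    v - (charDist α₁ x).starProjection v ∈ charDist α₂ x := by
  rw [← H.orthogonal_eq]
  exact Submodule.sub_starProjection_mem_orthogonal _

/-- Solves the formula for φ² on the distribution for the projected vector; the discarded component
lies in the kernel of α₂, so α₂ may be evaluated on `v`. Smoothness of the projection P thus reduces
to that of φ ∘ P. -/
theorem starProjection_eq (x : M) (v : TangentSpace 𝓘(ℝ, E) x) :
    (charDist α₁ x).starProjection v =
      -φ x (φ x ((charDist α₁ x).starProjection v)) + α₂ x v • Z₂ x := by
  have h1 := (mem_charDist_iff.mp (H.sub_starProjection_mem x v)).1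
  rw [map_sub, sub_eq_zero] at h1
  rw [H.sq_apply_of_mem (H.starProjection_mem x v), h1]
  abel

/-- The discarded component lies in the kernel of dα₂. Hence φ ∘ P is the metric dual of ½ dα₂, so
it is smooth without any frame of the distribution being known. -/
theorem inner_map_starProjection (x : M) (u v : TangentSpace 𝓘(ℝ, E) x) :
    inner ℝ u (φ x ((charDist α₁ x).starProjection v)) =
      (1 / 2 : ℝ) * extDerivOneForm α₂ x ![u, v] := by
  rw [H.inner_map_of_mem (H.starProjection_mem x v)]
  have h1 := (mem_charDist_iff.mp (H.sub_starProjection_mem x v)).2 u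
  have h2 : twoFormBilin (extDerivOneForm α₂ x)
    (v - (charDist α₁ x).starProjection v) u = 0 := h1
  rw [map_sub, LinearMap.sub_apply, sub_eq_zero, twoFormBilin_apply, twoFormBilin_apply] at h2
  rw [apply_swap _ v u, apply_swap _ _ u, h2]

theorem contMDiffAt_map {X : VecField E M} {x : M} (hX : CMDiffAt ∞ (T% X) x) :
    CMDiffAt ∞ (T% (fun y ↦ φ y (X y))) x :=
  ContMDiffAt.clm_bundle_apply (H.smooth x) hX

theorem contMDiffAt_reeb₂ (x : M) : CMDiffAt ∞ (T% Z₂) x :=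
  (H.reeb.smooth₂ x (Set.mem_univ x)).contMDiffAt Filter.univ_mem

/-- The orthogonal projection to the characteristic distribution preserves smoothness. -/
theorem contMDiffAt_starProjection {X : VecField E M} {x : M} (hX : CMDiffAt ∞ (T% X) x) :
    CMDiffAt ∞ (T% (fun y ↦ (charDist α₁ y).starProjection (X y))) x := by
  have h1 : CMDiffAt ∞ (T% (fun y ↦ φ y ((charDist α₁ y).starProjection (X y)))) x := by
    refine contMDiffAt_of_inner fun S hS ↦ ?_
    simp only [H.inner_map_starProjection]
    exact contMDiffAt_const.mul (H.smooth₂.contMDiffAt_extDeriv_apply hS hX)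
  have h2 : (fun y ↦ (charDist α₁ y).starProjection (X y)) =
      (-fun y ↦ φ y (φ y ((charDist α₁ y).starProjection (X y)))) +
        (fun y ↦ α₂ y (X y)) • Z₂ := by
    ext y
    exact H.starProjection_eq y (X y)
  have h3 := (H.contMDiffAt_map h1).neg_section.add_section
    ((H.smooth₂.contMDiffAt_apply le_rfl hX).smul_section (H.contMDiffAt_reeb₂ x))
  rw [← h2] at h3
  exact h3

end IsSplitMetricPair

end SplitMetricPair
end ContactPair

/-! ### The trace of ∇N over a characteristic distribution, and its mean curvature. -/

namespace ContactPair

theorem eq_sum_inner_smul {V : Type*} [NormedAddCommGroup V] [InnerProductSpace ℝ V]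
    {ι : Type*} [Fintype ι] {e : ι → V} (he : Orthonormal ℝ e)
    {D : Submodule ℝ V} [FiniteDimensional ℝ D] (heD : ∀ i, e i ∈ D)
    (hcard : Module.finrank ℝ D = Fintype.card ι) {u : V} (hu : u ∈ D) :
    u = ∑ i, inner ℝ (e i) u • e i := by
  have h1 : Submodule.span ℝ (Set.range e) = D := by
    refine Submodule.eq_of_le_of_finrank_eq (Submodule.span_le.mpr ?_) ?_
    · rintro _ ⟨i, rfl⟩
      exact heD i
    · rw [finrank_span_eq_card he.linearIndependent, hcard]
  rw [← h1, Submodule.mem_span_range_iff_exists_fun] at hu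
  obtain ⟨c, rfl⟩ := hu
  exact Finset.sum_congr rfl fun i _ ↦ by rw [he.inner_right_fintype]

section SplitMetricPair

open VectorField

variable {E : Type*} [NormedAddCommGroup E] [NormedSpace ℝ E] [FiniteDimensional ℝ E]
  {M : Type*} [TopologicalSpace M] [ChartedSpace E M] [IsManifold 𝓘(ℝ, E) ∞ M]
  [Bundle.RiemannianBundle (fun x : M ↦ TangentSpace 𝓘(ℝ, E) x)]
  [IsContMDiffRiemannianBundle 𝓘(ℝ, E) ∞ E (fun x : M ↦ TangentSpace 𝓘(ℝ, E) x)]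

theorem mvfderiv_inner {x : M} {Y Z : VecField E M} (hY : MDiffAt (T% Y) x)
    (hZ : MDiffAt (T% Z) x) (v : TangentSpace 𝓘(ℝ, E) x) :
    mvfderiv 𝓘(ℝ, E) (fun y ↦ inner ℝ (Y y) (Z y)) x v =
      inner ℝ (leviCivita Y x v) (Z x) + inner ℝ (Y x) (leviCivita Z x v) := by
  have h := (CovariantDerivative.isMetricCompatible_iff _).mp
    (leviCivita_isMetricCompatible (E := E) (M := M)) (X := FiberBundle.extend E v)
    (FiberBundle.mdifferentiableAt_extend ..) hY hZ
  simp only [FiberBundle.extend_apply_self] at h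
  exact h

/-- Vanishing torsion replaces ∇_X N by ∇_N X - [N, X], and metric compatibility gives ⟨∇_N X, X⟩ =
½ N|X|². -/
theorem inner_leviCivita_self {x : M} {N X : VecField E M} (hN : MDiffAt (T% N) x)
    (hX : MDiffAt (T% X) x) :
    inner ℝ (leviCivita N x (X x)) (X x) =
      (1 / 2 : ℝ) * mvfderiv 𝓘(ℝ, E) (fun y ↦ inner ℝ (X y) (X y)) x (N x) -
        inner ℝ (mlieBracket 𝓘(ℝ, E) N X x) (X x) := by
  have : CompleteSpace E := FiniteDimensional.complete ℝ E
  have h := (CovariantDerivative.torsion_eq_zero_iff _).mp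
    (leviCivita_torsion (E := E) (M := M)) hN hX
  rw [← h, mvfderiv_inner hX hX, inner_sub_left, real_inner_comm (leviCivita X x (N x)) (X x)]
  ring

variable {α₁ α₂ : OneForm E M} {Z₁ Z₂ : VecField E M} {φ : EndField E M}

namespace IsSplitMetricPair

variable {p₁ p₂ : ℕ} (H : IsSplitMetricPair α₁ α₂ Z₁ Z₂ φ p₁ p₂)
include H

/-- Since |Z₂| = 1, the left side is -α₂([N, Z₂]). This is dα₂(N, Z₂), because α₂(Z₂) and α₂(N) are
locally constant, and it vanishes because `N` lies in the kernel of dα₂. -/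
theorem inner_leviCivita_reeb {x : M} {N : VecField E M} (hN : CMDiffAt ∞ (T% N) x)
    (hND : ∀ᶠ y in 𝓝 x, N y ∈ charDist α₂ y) :
    inner ℝ (leviCivita N x (Z₂ x)) (Z₂ x) = (0 : ℝ) := by
  have dN : MDiffAt (T% N) x := hN.mdifferentiableAt (by simp)
  have dZ : MDiffAt (T% Z₂) x := (H.contMDiffAt_reeb₂ x).mdifferentiableAt (by simp)
  have h1 := extDerivOneForm_apply H.smooth₂ dN dZ
  have c1 : (fun y ↦ α₂ y (Z₂ y)) = fun _ ↦ (1 : ℝ) := funext H.reeb.apply₂₂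
  have c2 : (fun y ↦ α₂ y (N y)) =ᶠ[𝓝 x] fun _ ↦ (0 : ℝ) := by
    filter_upwards [hND] with y hy
    exact (mem_charDist_iff.mp hy).1
  have c3 : (fun y ↦ inner ℝ (Z₂ y) (Z₂ y)) = fun _ ↦ (1 : ℝ) := by
    ext y
    rw [H.inner_reeb₂, H.reeb.apply₂₂]
  have hc (c : ℝ) : mvfderiv 𝓘(ℝ, E) (fun _ : M ↦ c) x = 0 := mvfderiv_const c
  rw [c1, mvfderiv_congr c2, hc, hc, (mem_charDist_iff.mp hND.self_of_nhds).2] at h1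
  rw [inner_leviCivita_self dN dZ, c3, hc, H.inner_reeb₂]
  simp only [zero_apply] at h1 ⊢
  linarith

/-- The heart of the proof: L_N dα₂ = 0 evaluated on a field `X` extending `u` and on `Y` = φX,
where dα₂(X, Y) = -2|X|². -/
theorem inner_leviCivita_add_eq_zero {x : M} {N : VecField E M} (hN : CMDiffAt ∞ (T% N) x)
    (hND : ∀ᶠ y in 𝓝 x, N y ∈ charDist α₂ y) {u : TangentSpace 𝓘(ℝ, E) x}
    (hu : u ∈ charDist α₁ x) (hu2 : α₂ x u = 0) :
    inner ℝ (leviCivita N x u) u + inner ℝ (leviCivita N x (φ x u)) (φ x u) = (0 : ℝ) := by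
  let S : VecField E M := fun y ↦ (charDist α₁ y).starProjection (FiberBundle.extend E u y)
  have hS : CMDiffAt ∞ (T% S) x :=
    H.contMDiffAt_starProjection (FiberBundle.contMDiffAt_extend ..)
  -- Removing the `Z₂` component makes α₂(X) = 0 everywhere, so that φ²X = -X is an identity of
  -- fields that survives differentiation.
  let X : VecField E M := S - (fun y ↦ α₂ y (S y)) • Z₂
  have hX : CMDiffAt ∞ (T% X) x := hS.sub_section
    ((H.smooth₂.contMDiffAt_apply le_rfl hS).smul_section (H.contMDiffAt_reeb₂ x))
  have hXy (y) : X y = S y - α₂ y (S y) • Z₂ y := rfl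
  have hXD (y) : X y ∈ charDist α₁ y :=
    (charDist α₁ y).sub_mem (H.starProjection_mem y _)
      ((charDist α₁ y).smul_mem _ (H.reeb₂_mem y))
  have hX2 (y) : α₂ y (X y) = 0 := by
    rw [hXy, map_sub, map_smul, H.reeb.apply₂₂, smul_eq_mul, mul_one, sub_self]
  have hXx : X x = u := by
    have : S x = u := by
      simp only [S, FiberBundle.extend_apply_self]
      exact Submodule.starProjection_eq_self_iff.mpr hu
    rw [hXy, this, hu2, zero_smul, sub_zero]
  let Y : VecField E M := fun y ↦ φ y (X y)
  have hY : CMDiffAt ∞ (T% Y) x := H.contMDiffAt_map hX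
  have hφφ (y) : φ y (Y y) = -X y := by
    simp only [Y]
    rw [H.sq_apply_of_mem (hXD y), hX2, zero_smul, add_zero]
  have hYD (y) : Y y ∈ charDist α₁ y := H.dec₁ y _ (hXD y)
  have dY (y) (w : TangentSpace 𝓘(ℝ, E) y) :
      extDerivOneForm α₂ y ![w, Y y] = -2 * inner ℝ w (X y) := by
    have := H.inner_map_of_mem (u := w) (hYD y)
    rw [hφφ, inner_neg_right] at this
    linarith
  have dX (w : TangentSpace 𝓘(ℝ, E) x) :
      extDerivOneForm α₂ x ![X x, w] = -2 * inner ℝ w (Y x) := by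
    have : inner ℝ w (Y x) = (1 / 2 : ℝ) * extDerivOneForm α₂ x ![w, X x] :=
      H.inner_map_of_mem (hXD x)
    rw [this, apply_swap]
    ring
  -- φ is skew with φ²X = -X, hence preserves the length of `X`.
  have hYY : (fun y ↦ inner ℝ (Y y) (Y y)) = fun y ↦ (inner ℝ (X y) (X y) : ℝ) := by
    ext y
    have := H.inner_map_left y (X y) (Y y)
    rw [hφφ, inner_neg_right, neg_neg] at this
    exact this
  have h2 : (2 : WithTop ℕ∞) ≤ ∞ := by norm_cast
  have hL := mvfderiv_extDerivOneForm_of_contract_eq_zero H.smooth₂ (hN.of_le h2) (hX.of_le h2)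
    (hY.of_le h2) (hND.mono fun y hy ↦ (mem_charDist_iff.mp hy).2)
  simp only [dY, dX] at hL
  have hXX : MDiffAt (fun y ↦ (inner ℝ (X y) (X y) : ℝ)) x :=
    mdifferentiableAt_inner (hX.mdifferentiableAt (by simp)) (hX.mdifferentiableAt (by simp))
  have hc : mvfderiv 𝓘(ℝ, E) (fun y ↦ -2 * (inner ℝ (X y) (X y) : ℝ)) x (N x) =
      -2 * mvfderiv 𝓘(ℝ, E) (fun y ↦ (inner ℝ (X y) (X y) : ℝ)) x (N x) := by
    rw [mvfderiv_fun_mul mdifferentiableAt_const hXX, mvfderiv_const]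
    simp
  rw [hc] at hL
  have hN' : MDiffAt (T% N) x := hN.mdifferentiableAt (by simp)
  have e1 := inner_leviCivita_self hN' (hX.mdifferentiableAt (by simp))
  have e2 := inner_leviCivita_self hN' (hY.mdifferentiableAt (by simp))
  rw [hYY] at e2
  have hYx : Y x = φ x u := by simp only [Y, hXx]
  rw [hYx] at e2 hL
  rw [hXx] at e1 hL
  rw [e1, e2]
  linarith

/-- The trace over `ker α₁ ∩ ker dα₁` of `∇ N` vanishes for sections `N` of the complementary
characteristic distribution. -/
theorem sum_inner_leviCivita_eq_zero {x : M} {N : VecField E M} (hN : CMDiffAt ∞ (T% N) x)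
    (hND : ∀ᶠ y in 𝓝 x, N y ∈ charDist α₂ y) {ι : Type*} [Fintype ι]
    {e : ι → TangentSpace 𝓘(ℝ, E) x} (he : Orthonormal ℝ e) (heD : ∀ i, e i ∈ charDist α₁ x)
    (hcard : Fintype.card ι = p₁) :
    ∑ i, inner ℝ (leviCivita N x (e i)) (e i) = (0 : ℝ) := by
  classical
  refine sum_bilin_eq_zero he (charDist α₁ x) heD
    (fun u hu ↦ eq_sum_inner_smul he heD (by rw [H.finrank₁, hcard]) hu) (φ x).toLinearMap
    (H.dec₁ x) (H.inner_map_left x) (H.reeb₂_mem x)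
    (by rw [H.inner_reeb₂, H.reeb.apply₂₂]) (H.apply_reeb₂ x)
    (fun u hu ↦ (H.sq_apply_of_mem hu).trans (by rw [H.inner_reeb₂]))
    ((innerₗ (TangentSpace 𝓘(ℝ, E) x)).comp (leviCivita N x).toLinearMap)
    (H.inner_leviCivita_reeb hN hND) fun u hu hz ↦ ?_
  rw [H.inner_reeb₂] at hz
  exact H.inner_leviCivita_add_eq_zero hN hND hu hz

/-- The normal parts of covariant derivatives `A i`, in the directions of an orthonormal basis `e i`
of the characteristic distribution, of sections of that distribution extending `e i` sum to zero. -/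
theorem sum_starProjection_eq_zero {x : M} {ι : Type*} [Fintype ι]
    {e : ι → TangentSpace 𝓘(ℝ, E) x} (he : Orthonormal ℝ e) (heD : ∀ i, e i ∈ charDist α₁ x)
    (hcard : Fintype.card ι = p₁) (A : ι → TangentSpace 𝓘(ℝ, E) x)
    (hA : ∀ N : VecField E M, CMDiffAt ∞ (T% N) x → (∀ y, N y ∈ charDist α₂ y) →
      ∀ i, inner ℝ (A i) (N x) = (-inner ℝ (e i) (leviCivita N x (e i)) : ℝ)) :
    ∑ i, (charDist α₁ x)ᗮ.starProjection (A i) = 0 := by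
  -- The projection vanishes once Σ `A i` is orthogonal to every normal vector `n`. Such an `n` lies
  -- in the second distribution and extends to a section `N` of it, for which `hA` reduces the
  -- pairing to the trace of ∇N.
  rw [← map_sum]
  refine (Submodule.starProjection_apply_eq_zero_iff _).mpr ?_
  rw [Submodule.mem_orthogonal']
  intro n hn
  rw [H.orthogonal_eq] at hn
  let N : VecField E M := fun y ↦ (charDist α₂ y).starProjection (FiberBundle.extend E n y)
  have hNx : N x = n := by
    simp only [N, FiberBundle.extend_apply_self]
    exact Submodule.starProjection_eq_self_iff.mpr hn
  have hN : CMDiffAt ∞ (T% N) x :=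
    H.symm.contMDiffAt_starProjection (FiberBundle.contMDiffAt_extend ..)
  have hND (y) : N y ∈ charDist α₂ y := H.symm.starProjection_mem y _
  have h := H.sum_inner_leviCivita_eq_zero hN (.of_forall hND) he heD hcard
  rw [← hNx, sum_inner, Finset.sum_congr rfl fun i _ ↦ hA N hN hND i, Finset.sum_neg_distrib,
    neg_eq_zero, ← h]
  exact Finset.sum_congr rfl fun i _ ↦ real_inner_comm _ _

/-- For sections `V` and `N` of the two distributions ⟨V, N⟩ = 0 identically, so metric
compatibility gives ⟨∇_v V, N⟩ = -⟨v, ∇_v N⟩. -/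
theorem distMeanCurvature_eq_zero (x : M) : distMeanCurvature (charDist α₁) x = 0 := by
  refine H.sum_starProjection_eq_zero
    (e := fun i ↦ (stdOrthonormalBasis ℝ (charDist α₁ x) i : TangentSpace 𝓘(ℝ, E) x))
    ((stdOrthonormalBasis ℝ (charDist α₁ x)).orthonormal.comp_linearIsometry
      (charDist α₁ x).subtypeₗᵢ) (fun i ↦ (stdOrthonormalBasis ℝ (charDist α₁ x) i).2)
    (by rw [Fintype.card_fin, H.finrank₁])
    (fun i ↦ leviCivita (fun y ↦ (charDist α₁ y).starProjection (FiberBundle.extend E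
      (stdOrthonormalBasis ℝ (charDist α₁ x) i : TangentSpace 𝓘(ℝ, E) x) y)) x
      (stdOrthonormalBasis ℝ (charDist α₁ x) i : TangentSpace 𝓘(ℝ, E) x)) fun N hN hND i ↦ ?_
  obtain ⟨v, hvD⟩ := stdOrthonormalBasis ℝ (charDist α₁ x) i
  let V : VecField E M := fun y ↦ (charDist α₁ y).starProjection (FiberBundle.extend E v y)
  have hV : CMDiffAt ∞ (T% V) x :=
    H.contMDiffAt_starProjection (FiberBundle.contMDiffAt_extend ..)
  have hVx : V x = v := by
    simp only [V, FiberBundle.extend_apply_self]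
    exact Submodule.starProjection_eq_self_iff.mpr hvD
  have h := mvfderiv_inner (hV.mdifferentiableAt (by simp)) (hN.mdifferentiableAt (by simp)) v
  have h0 : (fun y ↦ inner ℝ (V y) (N y)) = fun _ ↦ (0 : ℝ) :=
    funext fun y ↦ H.inner_eq_zero (H.starProjection_mem y _) (hND y)
  have hc : mvfderiv 𝓘(ℝ, E) (fun _ : M ↦ (0 : ℝ)) x = 0 := mvfderiv_const 0
  rw [h0, hc, hVx, zero_apply] at h
  exact eq_neg_of_add_eq_zero_left h.symm

end IsSplitMetricPair

end SplitMetricPair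
end ContactPair

/-! ### Covariant derivatives along a map. -/

namespace ContactPair

open VectorField

/-- The product rule, with the derivative of `K` obtained by freezing `w` at `q`. The two terms
match the two terms of `covDerivAlong`. -/
theorem mvfderiv_clm_apply {E' : Type*} [NormedAddCommGroup E'] [NormedSpace ℝ E']
    {L : Type*} [TopologicalSpace L] [ChartedSpace E' L]
    {F : Type*} [NormedAddCommGroup F] [NormedSpace ℝ F] {K : L → F →L[ℝ] ℝ} {w : L → F} {q : L}
    (hK : MDiffAt K q) (hw : MDiffAt w q) (u : TangentSpace 𝓘(ℝ, E') q) :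
    mvfderiv 𝓘(ℝ, E') (fun y ↦ K y (w y)) q u =
      mvfderiv 𝓘(ℝ, E') (fun y ↦ K y (w q)) q u + K q (mvfderiv 𝓘(ℝ, E') w q u) := by
  have key (w' : L → F) (hw' : MDiffAt w' q) :
      mvfderiv 𝓘(ℝ, E') (fun y ↦ K y (w' y)) q u =
        K q (mvfderiv 𝓘(ℝ, E') w' q u) + (mvfderiv 𝓘(ℝ, E') K q u) (w' q) := by
    have h1 : HasMFDerivAt 𝓘(ℝ, E') 𝓘(ℝ, (F →L[ℝ] ℝ) × F) (fun y ↦ (K y, w' y)) q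
        ((mvfderiv 𝓘(ℝ, E') K q).prod (mvfderiv 𝓘(ℝ, E') w' q)) :=
      ⟨hK.continuousAt.prodMk hw'.continuousAt, hK.hasMFDerivAt.2.prodMk hw'.hasMFDerivAt.2⟩
    have h2 := ((isBoundedBilinearMap_apply (𝕜 := ℝ) (E := F) (F := ℝ)).hasFDerivAt
      (K q, w' q)).hasMFDerivAt
    have h3 := (HasMFDerivAt.comp q h2 h1).mfderiv
    exact DFunLike.congr_fun h3 u
  rw [key w hw, key (fun _ ↦ w q) mdifferentiableAt_const, mvfderiv_const]
  simp [add_comm]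

variable {E : Type*} [NormedAddCommGroup E] [NormedSpace ℝ E] [FiniteDimensional ℝ E]
  {M : Type*} [TopologicalSpace M] [ChartedSpace E M] [IsManifold 𝓘(ℝ, E) ∞ M]
  [Bundle.RiemannianBundle (fun x : M ↦ TangentSpace 𝓘(ℝ, E) x)]
  [IsContMDiffRiemannianBundle 𝓘(ℝ, E) ∞ E (fun x : M ↦ TangentSpace 𝓘(ℝ, E) x)]

section Along

variable {p : ℕ} {L : Type*} [TopologicalSpace L] [ChartedSpace (EuclideanSpace ℝ (Fin p)) L]

/-- The coefficients of the inner product with `N` in the trivialization of `TM` at `x`. -/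
def innerCoeff (N : VecField E M) (x y : M) : E →L[ℝ] ℝ :=
  LinearMap.toContinuousLinearMap ((innerₗ (TangentSpace 𝓘(ℝ, E) y) (N y)).comp
    ((trivializationAt E (TangentSpace 𝓘(ℝ, E)) x).symmₗ ℝ y))

theorem innerCoeff_apply (N : VecField E M) {x y : M}
    (hy : y ∈ (trivializationAt E (TangentSpace 𝓘(ℝ, E)) x).baseSet) (a : E) :
    innerCoeff N x y a =
      inner ℝ ((trivializationAt E (TangentSpace 𝓘(ℝ, E)) x).symm y a) (N y) := by
  rw [real_inner_comm]
  exact congrArg (inner ℝ (N y))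
    (congrFun ((trivializationAt E (TangentSpace 𝓘(ℝ, E)) x).coe_symmₗ (R := ℝ) hy) a)

theorem innerCoeff_eventuallyEq_inner_extend (N : VecField E M) {x : M}
    (v : TangentSpace 𝓘(ℝ, E) x) :
    (fun y ↦ innerCoeff N x y ((trivializationAt E (TangentSpace 𝓘(ℝ, E)) x
        (⟨x, v⟩ : TangentBundle 𝓘(ℝ, E) M)).2)) =ᶠ[𝓝 x]
      fun y ↦ inner ℝ (FiberBundle.extend E v y) (N y) := by
  filter_upwards [(trivializationAt E (TangentSpace 𝓘(ℝ, E)) x).open_baseSet.mem_nhds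
    (FiberBundle.mem_baseSet_trivializationAt' x)] with y hy
  exact innerCoeff_apply N hy _

theorem contMDiffAt_innerCoeff {N : VecField E M} {x : M} (hN : CMDiffAt ∞ (T% N) x) :
    CMDiffAt ∞ (innerCoeff N x) x := by
  obtain ⟨b, Φ, hΦ⟩ := exists_clm_eq_apply E
  have hfun : innerCoeff N x = Φ ∘ fun y i ↦ innerCoeff N x y (b i) := by
    ext1 y
    exact hΦ _
  have hx : x ∈ (trivializationAt E (TangentSpace 𝓘(ℝ, E)) x).baseSet :=
    FiberBundle.mem_baseSet_trivializationAt' x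
  rw [hfun]
  refine Φ.contDiff.contDiffAt.contMDiffAt.comp x (contMDiffAt_pi_space.mpr fun i ↦ ?_)
  have h := innerCoeff_eventuallyEq_inner_extend N
    ((trivializationAt E (TangentSpace 𝓘(ℝ, E)) x).symm x (b i))
  rw [congrArg Prod.snd
    ((trivializationAt E (TangentSpace 𝓘(ℝ, E)) x).apply_mk_symm hx (b i))] at h
  exact (contMDiffAt_inner (FiberBundle.contMDiffAt_extend ..) hN).congr_of_eventuallyEq h

/-- The covariant derivative along a map is compatible with the metric, for a vector field along
the map that is orthogonal to `N`. -/
theorem inner_covDerivAlong {f : L → M} {W : Π q : L, TangentSpace 𝓘(ℝ, E) (f q)} {q : L}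
    (hf : MDifferentiableAt 𝓘(ℝ, EuclideanSpace ℝ (Fin p)) 𝓘(ℝ, E) f q)
    (hW : MDifferentiableAt 𝓘(ℝ, EuclideanSpace ℝ (Fin p)) 𝓘(ℝ, E).tangent
      (fun q' ↦ (⟨f q', W q'⟩ : TangentBundle 𝓘(ℝ, E) M)) q)
    {N : VecField E M} (hN : CMDiffAt ∞ (T% N) (f q))
    (hWN : ∀ q', inner ℝ (W q') (N (f q')) = (0 : ℝ))
    (u : TangentSpace 𝓘(ℝ, EuclideanSpace ℝ (Fin p)) q) :
    inner ℝ (covDerivAlong (E := E) f W q u) (N (f q)) =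
      (-inner ℝ (W q)
        (leviCivita N (f q) (mfderiv 𝓘(ℝ, EuclideanSpace ℝ (Fin p)) 𝓘(ℝ, E) f q u)) : ℝ) := by
  set t := trivializationAt E (TangentSpace 𝓘(ℝ, E)) (f q) with ht
  let w : L → E := fun q' ↦ (t (⟨f q', W q'⟩ : TangentBundle 𝓘(ℝ, E) M)).2
  have hw : MDifferentiableAt 𝓘(ℝ, EuclideanSpace ℝ (Fin p)) 𝓘(ℝ, E) w q :=
    ((mdifferentiableAt_totalSpace _ _).1 hW).2
  have hK := (contMDiffAt_innerCoeff hN).mdifferentiableAt (by simp)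
  have dN : MDiffAt (T% N) (f q) := hN.mdifferentiableAt (by simp)
  have hfq : f q ∈ t.baseSet := FiberBundle.mem_baseSet_trivializationAt' (f q)
  have hKf : MDifferentiableAt 𝓘(ℝ, EuclideanSpace ℝ (Fin p)) 𝓘(ℝ, E →L[ℝ] ℝ)
      (fun q' ↦ innerCoeff N (f q) (f q')) q := hK.comp q hf
  have h1 := mvfderiv_clm_apply hKf hw u
  -- Near `q` this function is ⟨W, N ∘ f⟩ written in the trivialization, which vanishes by
  -- orthogonality.
  have h2 : (fun q' ↦ innerCoeff N (f q) (f q') (w q')) =ᶠ[𝓝 q] fun _ ↦ (0 : ℝ) := by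
    have hb : ∀ᶠ q' in 𝓝 q, f q' ∈ t.baseSet :=
      hf.continuousAt.eventually (t.open_baseSet.mem_nhds hfq)
    filter_upwards [hb] with q' hq'
    rw [innerCoeff_apply N hq', ← hWN q']
    congr 1
    exact t.symm_apply_apply_mk hq' (W q')
  have h3 : mvfderiv 𝓘(ℝ, EuclideanSpace ℝ (Fin p))
      (fun q' ↦ innerCoeff N (f q) (f q') (w q')) q u = 0 := by
    rw [mvfderiv_congr h2, mvfderiv_const]
    rfl
  have hS : MDiffAt (T% (FiberBundle.extend E (W q) : VecField E M)) (f q) :=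
    FiberBundle.mdifferentiableAt_extend ..
  -- With the coordinates of `W` frozen at `q` the function is ⟨S, N⟩ ∘ f, where `S` is the
  -- extension of `W q`; the chain rule and metric compatibility on `M` apply.
  have h4 : mvfderiv 𝓘(ℝ, EuclideanSpace ℝ (Fin p))
      (fun q' ↦ innerCoeff N (f q) (f q') (w q)) q u =
        inner ℝ (leviCivita (FiberBundle.extend E (W q)) (f q)
            (mfderiv 𝓘(ℝ, EuclideanSpace ℝ (Fin p)) 𝓘(ℝ, E) f q u)) (N (f q)) +
          inner ℝ (W q) (leviCivita N (f q)
            (mfderiv 𝓘(ℝ, EuclideanSpace ℝ (Fin p)) 𝓘(ℝ, E) f q u)) := by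
    have h5 := mvfderiv_comp_apply q (mdifferentiableAt_inner hS dN) hf u
    rw [mvfderiv_inner hS dN] at h5
    simp only [FiberBundle.extend_apply_self] at h5
    rw [← h5]
    exact DFunLike.congr_fun (mvfderiv_congr (hf.continuousAt.eventually
      (innerCoeff_eventuallyEq_inner_extend N (W q)))) u
  rw [h3, h4, innerCoeff_apply N hfq] at h1
  rw [covDerivAlong, inner_add_left]
  linarith

end Along

/-- The field along `f` is the tangent map of `f` composed with a differentiable section of the
tangent bundle of `L`. -/
theorem IsIntegralManifold.mdifferentiableAt_mfderiv_extend {D : Distribution E M} {p : ℕ}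
    {L : Type*} [TopologicalSpace L] [ChartedSpace (EuclideanSpace ℝ (Fin p)) L]
    [IsManifold 𝓘(ℝ, EuclideanSpace ℝ (Fin p)) ∞ L] {f : L → M}
    (hf : IsIntegralManifold (p := p) D f) {q : L}
    (v : TangentSpace 𝓘(ℝ, EuclideanSpace ℝ (Fin p)) q) :
    MDifferentiableAt 𝓘(ℝ, EuclideanSpace ℝ (Fin p)) 𝓘(ℝ, E).tangent
      (fun q' ↦ (⟨f q', mfderiv 𝓘(ℝ, EuclideanSpace ℝ (Fin p)) 𝓘(ℝ, E) f q'
        (FiberBundle.extend (EuclideanSpace ℝ (Fin p)) v q')⟩ : TangentBundle 𝓘(ℝ, E) M)) q := by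
  have : IsManifold 𝓘(ℝ, EuclideanSpace ℝ (Fin p)) 1 L := .of_le (n := ∞) (by norm_cast)
  have : IsManifold 𝓘(ℝ, E) 1 M := .of_le (n := ∞) (by norm_cast)
  have h1 := (hf.contMDiff.contMDiff_tangentMap (m := 1) (by norm_cast)).mdifferentiable
    (by simp)
  have h2 : MDifferentiableAt 𝓘(ℝ, EuclideanSpace ℝ (Fin p))
      𝓘(ℝ, EuclideanSpace ℝ (Fin p)).tangent
      (fun q' ↦ (⟨q', FiberBundle.extend (EuclideanSpace ℝ (Fin p)) v q'⟩ :
        TangentBundle 𝓘(ℝ, EuclideanSpace ℝ (Fin p)) L)) q := FiberBundle.mdifferentiableAt_extend ..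
  exact (h1 _).comp q h2

/-! ### Minimal leaves, local frames and integrability. -/

variable {α₁ α₂ : OneForm E M} {Z₁ Z₂ : VecField E M} {φ : EndField E M}

namespace IsSplitMetricPair

variable {p₁ p₂ : ℕ} (H : IsSplitMetricPair α₁ α₂ Z₁ Z₂ φ p₁ p₂)
include H

/-- The image under the derivative of `f` of a field on `L` is tangent to the first distribution,
hence orthogonal to every section `N` of the second along `f`; `inner_covDerivAlong` then supplies
the hypothesis on `A` in `sum_starProjection_eq_zero`. -/
theorem isMinimalImmersion {L : Type*} [TopologicalSpace L]
    [ChartedSpace (EuclideanSpace ℝ (Fin p₁)) L] [IsManifold 𝓘(ℝ, EuclideanSpace ℝ (Fin p₁)) ∞ L]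
    {f : L → M} (hf : IsIntegralManifold (p := p₁) (charDist α₁) f) :
    IsMinimalImmersion (E := E) (p := p₁) f := by
  intro q e he
  have hmem (q' : L) (v) : mfderiv 𝓘(ℝ, EuclideanSpace ℝ (Fin p₁)) 𝓘(ℝ, E) f q' v ∈
      charDist α₁ (f q') := by
    rw [← hf.range_mfderiv q']
    exact LinearMap.mem_range_self _ v
  simp only [secondFundamentalForm, hf.range_mfderiv q]
  refine H.sum_starProjection_eq_zero he (fun i ↦ hmem q _) (Fintype.card_fin _) _
    fun N hN hND i ↦ ?_
  rw [inner_covDerivAlong (hf.contMDiff.mdifferentiable (by simp) q)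
    (hf.mdifferentiableAt_mfderiv_extend (e i)) hN
    (fun q' ↦ H.inner_eq_zero (hmem q' _) (hND (f q'))), FiberBundle.extend_apply_self]

/-- Project extensions of a basis at `x`. Nonvanishing of the Gram determinant is an open condition,
and the constant rank turns independence into spanning. -/
theorem exists_local_frame (x : M) : ∃ U : Set M, IsOpen U ∧ x ∈ U ∧
    ∃ X : Fin p₁ → VecField E M, (∀ i, IsSmoothOn (X i) U) ∧
      ∀ y ∈ U, Submodule.span ℝ (Set.range fun i ↦ X i y) = charDist α₁ y := by
  let b := Module.finBasisOfFinrankEq ℝ (charDist α₁ x) (H.finrank₁ x)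
  let v (i) : TangentSpace 𝓘(ℝ, E) x := (b i).1
  have hv : LinearIndependent ℝ v :=
    b.linearIndependent.map' (charDist α₁ x).subtype (Submodule.ker_subtype _)
  let X (i) : VecField E M := fun y ↦ (charDist α₁ y).starProjection (FiberBundle.extend E (v i) y)
  have hX : ∀ᶠ y in 𝓝 x, ∀ i, CMDiffAt ∞ (T% (X i)) y := by
    refine Filter.eventually_all.mpr fun i ↦ ?_
    obtain ⟨s, hs, hsX⟩ := FiberBundle.exists_contMDiffOn_extend (k := ∞) 𝓘(ℝ, E) E (v i)
    filter_upwards [eventually_mem_nhds_iff.mpr hs] with y hy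
    exact H.contMDiffAt_starProjection (hsX.contMDiffAt hy)
  have hXx : (fun i ↦ X i x) = v := by
    ext i
    simp only [X, FiberBundle.extend_apply_self]
    exact Submodule.starProjection_eq_self_iff.mpr (b i).2
  have hdet : ∀ᶠ y in 𝓝 x, (Matrix.gram ℝ fun i ↦ X i y).det ≠ 0 := by
    have hc : CMDiffAt ∞ (fun y ↦ (Matrix.gram ℝ fun i ↦ X i y).det) x :=
      contMDiffAt_det fun i j ↦ contMDiffAt_inner (hX.self_of_nhds i) (hX.self_of_nhds j)
    refine hc.continuousAt.eventually_ne ?_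
    rw [hXx]
    exact Matrix.det_gram_ne_zero_iff_linearIndependent.mpr hv
  obtain ⟨U, hU, hUo, hxU⟩ := eventually_nhds_iff.mp (hX.and hdet)
  refine ⟨U, hUo, hxU, X, fun i y hy ↦ ((hU y hy).1 i).contMDiffWithinAt, fun y hy ↦ ?_⟩
  refine Submodule.eq_of_le_of_finrank_eq (Submodule.span_le.mpr ?_) ?_
  · rintro _ ⟨i, rfl⟩
    exact H.starProjection_mem y _
  · rw [finrank_span_eq_card
      (Matrix.det_gram_ne_zero_iff_linearIndependent.mp (hU y hy).2), Fintype.card_fin, H.finrank₁]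

/-- First, α₁([X, Y]) = -dα₁(X, Y) = 0. Next, L_X dα₁ = 0 applied to `Y` and an arbitrary extension
of `u` leaves dα₁([X, Y], u) = 0, since every other term contains dα₁(Y, ·). -/
theorem mlieBracket_mem {U : Set M} (hU : IsOpen U) {X Y : VecField E M} (hX : IsSmoothOn X U)
    (hY : IsSmoothOn Y U) (hXD : ∀ y ∈ U, X y ∈ charDist α₁ y) (hYD : ∀ y ∈ U, Y y ∈ charDist α₁ y)
    {x : M} (hx : x ∈ U) : mlieBracket 𝓘(ℝ, E) X Y x ∈ charDist α₁ x := by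
  have hUx : U ∈ 𝓝 x := hU.mem_nhds hx
  have cX : CMDiffAt ∞ (T% X) x := hX.contMDiffAt hUx
  have cY : CMDiffAt ∞ (T% Y) x := hY.contMDiffAt hUx
  have h2 : (2 : WithTop ℕ∞) ≤ ∞ := by norm_cast
  have hz {g : M → ℝ} (hg : ∀ y ∈ U, g y = 0) : mvfderiv 𝓘(ℝ, E) g x = 0 := by
    rw [mvfderiv_congr (g := fun _ ↦ (0 : ℝ)) (Filter.eventually_of_mem hUx hg), mvfderiv_const]
  refine mem_charDist_iff.mpr ⟨?_, fun u ↦ ?_⟩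
  · have h := extDerivOneForm_apply H.smooth₁ (cX.mdifferentiableAt (by simp))
      (cY.mdifferentiableAt (by simp))
    rw [hz fun y hy ↦ (mem_charDist_iff.mp (hXD y hy)).1,
      hz fun y hy ↦ (mem_charDist_iff.mp (hYD y hy)).1,
      (mem_charDist_iff.mp (hXD x hx)).2] at h
    simpa using h.symm
  · have cS : CMDiffAt ∞ (T% (FiberBundle.extend E u : VecField E M)) x :=
      FiberBundle.contMDiffAt_extend ..
    have h := mvfderiv_extDerivOneForm_of_contract_eq_zero H.smooth₁ (cX.of_le h2) (cY.of_le h2)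
      (cS.of_le h2) (Filter.eventually_of_mem hUx fun y hy ↦ (mem_charDist_iff.mp (hXD y hy)).2)
    rw [hz fun y hy ↦ (mem_charDist_iff.mp (hYD y hy)).2 _,
      (mem_charDist_iff.mp (hYD x hx)).2, FiberBundle.extend_apply_self] at h
    simpa using h.symm

theorem isIntegrable : IsIntegrable (charDist α₁) p₁ where
  finrank_eq := H.finrank₁
  smooth := H.exists_local_frame
  involutive _ hU _ _ hX hY hXD hYD _ hx := H.mlieBracket_mem hU hX hY hXD hYD hx

end IsSplitMetricPair

theorem IsSplitMetricPair.isMinimalFoliation {M : Type u} [TopologicalSpace M] [ChartedSpace E M]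
    [IsManifold 𝓘(ℝ, E) ∞ M]
    [Bundle.RiemannianBundle (fun x : M ↦ TangentSpace 𝓘(ℝ, E) x)]
    [IsContMDiffRiemannianBundle 𝓘(ℝ, E) ∞ E (fun x : M ↦ TangentSpace 𝓘(ℝ, E) x)]
    {α₁ α₂ : OneForm E M} {Z₁ Z₂ : VecField E M} {φ : EndField E M} {p₁ p₂ : ℕ}
    (H : IsSplitMetricPair α₁ α₂ Z₁ Z₂ φ p₁ p₂) : IsMinimalFoliation (charDist α₁) p₁ where
  integrable := H.isIntegrable
  meanCurvature_eq_zero := H.distMeanCurvature_eq_zero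
  leaf_minimal _ _ _ _ _ hf := H.isMinimalImmersion hf.toIsIntegralManifold

end ContactPair

end

theorem mainTheorem2
    {E : Type*} [NormedAddCommGroup E] [NormedSpace ℝ E] [FiniteDimensional ℝ E]
    {M : Type*} [TopologicalSpace M] [ChartedSpace E M] [IsManifold 𝓘(ℝ, E) ∞ M]
    [T2Space M] [SecondCountableTopology M]
    [Bundle.RiemannianBundle (fun x : M ↦ TangentSpace 𝓘(ℝ, E) x)]
    [IsContMDiffRiemannianBundle 𝓘(ℝ, E) ∞ E (fun x : M ↦ TangentSpace 𝓘(ℝ, E) x)]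
    (h k : ℕ) (α₁ α₂ : ContactPair.OneForm E M) (Z₁ Z₂ : ContactPair.VecField E M)
    (φ : ContactPair.EndField E M)
    (hmcp : ContactPair.IsMetricContactPair h k α₁ α₂ Z₁ Z₂ φ)
    (hdec : ContactPair.IsDecomposable α₁ α₂ φ) :
    ContactPair.IsMinimalFoliation (ContactPair.charDist α₁) (2 * k + 1) ∧
      ContactPair.IsMinimalFoliation (ContactPair.charDist α₂) (2 * h + 1) := by
  have H := hmcp.isSplitMetricPair hdec
  exact ⟨H.isMinimalFoliation, H.symm.isMinimalFoliation⟩
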